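/- **Setting.** For elements $x,y,z_1,z_2,\dots$ of a monoid put $\lambda_0=x$, $\rho_0=y$, $\lambda_{n+1}=\lambda_n z_{n+1}\rho_n$, $\rho_{n+1}=\rho_n z_{n+1}\lambda_n$. On a semigroup $S$ let $\eta_1$ be equality and, for $n>1$, let $x\,\eta_n\,y$ mean that there are $z_1,\dots,z_n\in S^1$ with $x=\lambda_n(x,y,z_1,\dots,z_n)$ and $y=\rho_n(x,y,z_1,\dots,z_n)$. Let $\eta$ be the transitive closure of $\bigcup_{n\ge1}\eta_n$ and $\eta^*$ the smallest congruence on $S$ containing $\eta$. Let $S$ be a finite semigroup with a principal series $S=S_1\supset S_2\supset\dots\supset S_o\supset S_{o+1}=\emptyset$ (each $S_q$ is an ideal, the inclusions are strict, and no ideal lies strictly between $S_q$ and $S_{q+1}$). The zero of $S$, if there is one, is denoted $\theta$; if $S$ has no zero, no element is $\eta^*$-related to $\theta$. $\mathcal M^0(G,n,m;P)$ denotes the Rees matrix semigroup over a group $G$ with $m\times n$ sandwich matrix $P=(p_{ji})$ over $G\cup\{\theta\}$; its nonzero elements are the triples $(g;i,j)$ with $g\in G$, $1\le i\le n$, $1\le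 j\le m$, and $(g;i,j)(h;k,l)=(g\,p_{jk}h;i,l)$ if $p_{jk}\ne\theta$ and $\theta$ otherwise. It is regular if every row and every column of $P$ has a nonzero entry. A regular one is *CS-diagonal* if $p_{r,t},p_{r',t},p_{r,t'}\neq\theta$ imply $p_{r',t'}\ne\theta$. In that case "$p_{j,i}$ and $p_{j,i'}$ are nonzero for some $j$" is an equivalence relation on $i,i'\in\{1,\dots,n\}$; let $\mathbb I_1,\dots,\mathbb I_{n_{\eta^*}}$ be its classes, and let $\mathbb I'_k$ be the set of the $j$ with $p_{j,i}\neq\theta$ for some $i\in\mathbb I_k$. A principal factor $S_q/S_{q+1}$ is called a CS-diagonal Rees matrix semigroup if it is isomorphic to a CS-diagonal $\mathcal M^0(G,n,m;P)$ or, when $S_{q+1}=\emptyset$, to the semigroup of nonzero elements of one in which all entries of $P$ are nonzero. Elements of $S_q\setminus S_{q+1}$ are then written as triples. Let $S_p/S_{p+1}$ be a CS-diagonal principal factor with matrix $P$ as above. The *minimal non-nilpotent representation* $\Gamma$ of $S/S_{p+1}$ assigns to each $s\in S/S_{p+1}$ a transformation of $\{1,\dots,n_{\eta^*}\}\cup\{\theta\}$: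 $\Gamma(s)(i)=i'$ if $s(g;\alpha,\beta)=(g';\alpha',\beta)$ for some $g,g'\in G$, $\alpha\in\mathbb I_i$, $\alpha'\in\mathbb I_{i'}$, $1\le\beta\le m$; $\Gamma(s)(i)=\theta$ if there is no such $i'$; and $\Gamma(s)(\theta)=\theta$. We say that *$\theta$ is the $\eta^*$-root* of $S_p/S_{p+1}$ if $S$ has a zero $\theta$ and $a\,\eta^*\,\theta$ for some $a\in S_p\setminus S_{p+1}$. If some $a\in S_p\setminus S_{p+1}$ is not $\eta^*$-related to $\theta$, a principal factor $S_{p'}/S_{p'+1}$ with $p\le p'\le o$ is *the $\eta^*$-root* of $S_p/S_{p+1}$ if 1. every $x\in S_p\setminus S_{p+1}$ is $\eta^*$-related to some $y\in S_{p'}\setminus S_{p'+1}$; 2. no element of $(S_p\setminus S_{p+1})\cup(S_{p'}\setminus S_{p'+1})$ is $\eta^*$-related to an element of $S_{p'+1}$; 3. $S_{p'}/S_{p'+1}$ is a CS-diagonal regular Rees matrix semigroup; 4. if $(g;\alpha,\beta),(g';\gamma,\delta)\in S_p\setminus S_{p+1}$ with $p_{\beta,\gamma}\ne\theta$, and $(h;i,j),(h';k,l)\in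 S_{p'}\setminus S_{p'+1}$ with $(g;\alpha,\beta)\,\eta^*\,(h;i,j)$ and $(g';\gamma,\delta)\,\eta^*\,(h';k,l)$, then $k\in\mathbb I_r$ and $j\in\mathbb I'_r$ for some $r$ (classes taken in $S_{p'}/S_{p'+1}$). In that case $\phi_{\eta^*}$ is the function from $\{1,\dots,n\}$ to the set of classes $\mathbb I_r$ of $S_{p'}/S_{p'+1}$ with $\phi_{\eta^*}(\alpha)=\mathbb I_r$ whenever $(g;\alpha,\beta)\,\eta^*\,(h;i,j)$ for some $(g;\alpha,\beta)\in S_p\setminus S_{p+1}$ and $(h;i,j)\in S_{p'}\setminus S_{p'+1}$ with $i\in\mathbb I_r$; for $1\le k\le n_{\eta^*}$, $\phi_{\eta^*}(k)$ denotes the common value of $\phi_{\eta^*}$ on the class $\mathbb I_k$ of $S_p/S_{p+1}$. **Theorem.** Let $1\le p\le o$ and let $S_p/S_{p+1}$ be a CS-diagonal principal factor of $S$, with a matrix $P$ as above. Suppose that there are $k_1,k_2,k_3,k_4\in\{1,\dots,n_{\eta^*}\}$ with $k_1\ne k_3$ and $v_1,v_2\in S\setminus S_{p+1}$ such that $$\Gamma(v_1)(k_1)=k_2,\quad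 \Gamma(v_1)(k_3)=k_4,\quad \Gamma(v_2)(k_1)=k_4,\quad \Gamma(v_2)(k_3)=k_2 .$$ Then at least one of the following holds: 1. $S_p/S_{p+1}$ has an $\eta^*$-root $S_{p'}/S_{p'+1}$ with $p'\ne p$, the function $\phi_{\eta^*}$ is well defined (for every choice of Rees coordinates of $S_{p'}/S_{p'+1}$), and $\phi_{\eta^*}(k_1)=\phi_{\eta^*}(k_3)$ and $\phi_{\eta^*}(k_2)=\phi_{\eta^*}(k_4)$; 2. the $\eta^*$-root of $S_p/S_{p+1}$ is $\theta$. -/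

import Mathlib

universe u v w

namespace EtaStar

/-! ### The congruence `η*` -/

section Eta

/-- `malcev x y z n = (λ_n(x, y, z 1, …, z n), ρ_n(x, y, z 1, …, z n))`, where `λ_0 = x`, `ρ_0 = y`,
`λ_{n+1} = λ_n z_{n+1} ρ_n` and `ρ_{n+1} = ρ_n z_{n+1} λ_n`. -/
def malcev {M : Type u} [Mul M] (x y : M) (z : ℕ → M) : ℕ → M × M
  | 0 => (x, y)
  | n + 1 =>
    ((malcev x y z n).1 * z (n + 1) * (malcev x y z n).2,
      (malcev x y z n).2 * z (n + 1) * (malcev x y z n).1)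

/-- The relation `η_n`: equality for `n = 1`; for `n > 1`, `x η_n y` iff `x = λ_n(x, y, z₁, …, z_n)`
and `y = ρ_n(x, y, z₁, …, z_n)` for some `z₁, …, z_n` in `S¹`. (Only `z 1, …, z n` matter.
If `S` already has an identity, the adjoined one acts on `S` in the same way, so that it makes
no difference whether or not it is adjoined.) -/
def etaN {S : Type u} [Semigroup S] (n : ℕ) (x y : S) : Prop :=
  (n = 1 ∧ x = y) ∨
    (1 < n ∧ ∃ z : ℕ → WithOne S, malcev (x : WithOne S) (y : WithOne S) z n = (↑x, ↑y))

/-- `η` is the transitive closure of the union of the `η_n`, `n ≥ 1`. -/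
def eta {S : Type u} [Semigroup S] : S → S → Prop :=
  Relation.TransGen fun x y => ∃ n : ℕ, 1 ≤ n ∧ etaN n x y

/-- `η*` is the smallest congruence on `S` that contains `η`. -/
def etaStar (S : Type u) [Semigroup S] : Con S :=
  conGen eta

/-- `θ` is a zero element of `S`. -/
def IsZeroElt {S : Type u} [Semigroup S] (θ : S) : Prop :=
  ∀ s : S, s * θ = θ ∧ θ * s = θ

end Eta

/-! ### Ideals, Rees quotients and principal series -/

/-- A two-sided ideal of a semigroup; the empty set is allowed. -/
structure SgIdeal (S : Type u) [Semigroup S] where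
  carrier : Set S
  mul_left_mem : ∀ s : S, ∀ a ∈ carrier, s * a ∈ carrier
  mul_right_mem : ∀ s : S, ∀ a ∈ carrier, a * s ∈ carrier

/-- An ideal as a subsemigroup. -/
def SgIdeal.toSubsemigroup {S : Type u} [Semigroup S] (A : SgIdeal S) : Subsemigroup S where
  carrier := A.carrier
  mul_mem' := fun {a b} _ hb => A.mul_left_mem a b hb

/-- The Rees congruence of an ideal `B`: the elements of `B` are identified with each other, and
nothing else is. For `B = ∅` this is equality. -/
def SgIdeal.reesCon {S : Type u} [Semigroup S] (B : SgIdeal S) : Con S where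
  r x y := x = y ∨ (x ∈ B.carrier ∧ y ∈ B.carrier)
  iseqv :=
    { refl := fun _ => Or.inl rfl
      symm := by
        rintro x y (h | ⟨h₁, h₂⟩)
        · exact Or.inl h.symm
        · exact Or.inr ⟨h₂, h₁⟩
      trans := by
        rintro x y z (rfl | ⟨h₁, h₂⟩) (rfl | ⟨h₃, h₄⟩)
        · exact Or.inl rfl
        · exact Or.inr ⟨h₃, h₄⟩
        · exact Or.inr ⟨h₁, h₂⟩
        · exact Or.inr ⟨h₁, h₄⟩ }
  mul' := by
    rintro a b c d (rfl | ⟨h₁, h₂⟩) (rfl | ⟨h₃, h₄⟩)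
    · exact Or.inl rfl
    · exact Or.inr ⟨B.mul_left_mem _ _ h₃, B.mul_left_mem _ _ h₄⟩
    · exact Or.inr ⟨B.mul_right_mem _ _ h₁, B.mul_right_mem _ _ h₂⟩
    · exact Or.inr ⟨B.mul_left_mem _ _ h₃, B.mul_left_mem _ _ h₄⟩

/-- The Rees quotient `S / B` (with `S / ∅ = S`). -/
abbrev SgIdeal.ReesQuotient {S : Type u} [Semigroup S] (B : SgIdeal S) : Type u :=
  B.reesCon.Quotient

/-- The projection `S → S / B`. -/
def SgIdeal.proj {S : Type u} [Semigroup S] (B : SgIdeal S) : S →ₙ* B.ReesQuotient where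
  toFun x := (x : B.reesCon.Quotient)
  map_mul' _ _ := rfl

/-- The factor `A / B` of two ideals, as a subsemigroup of `S / B`. -/
def factor {S : Type u} [Semigroup S] (A B : SgIdeal S) : Subsemigroup B.ReesQuotient :=
  A.toSubsemigroup.map B.proj

/-- The class of `x ∈ A` in the factor `A / B`. -/
def factor.mk {S : Type u} [Semigroup S] {A : SgIdeal S} (B : SgIdeal S) (x : S)
    (hx : x ∈ A.carrier) : factor A B :=
  ⟨B.proj x, x, hx, rfl⟩

/-- A principal series `S = S_1 ⊃ S_2 ⊃ … ⊃ S_o ⊃ S_{o+1} = ∅` of ideals, with no ideal strictly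
between `S_p` and `S_{p+1}`. The values of `ideal` outside `1, …, o + 1` play no role. -/
structure PrincipalSeries (S : Type u) [Semigroup S] where
  o : ℕ
  ideal : ℕ → SgIdeal S
  first : (ideal 1).carrier = Set.univ
  last : (ideal (o + 1)).carrier = ∅
  strict : ∀ p, 1 ≤ p → p ≤ o → (ideal (p + 1)).carrier ⊂ (ideal p).carrier
  no_between : ∀ p, 1 ≤ p → p ≤ o → ∀ I : SgIdeal S,
    (ideal (p + 1)).carrier ⊆ I.carrier → I.carrier ⊆ (ideal p).carrier →
      I.carrier = (ideal (p + 1)).carrier ∨ I.carrier = (ideal p).carrier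

/-- The set `S_p ∖ S_{p+1}`. -/
def PrincipalSeries.layer {S : Type u} [Semigroup S] (σ : PrincipalSeries S) (p : ℕ) : Set S :=
  (σ.ideal p).carrier \ (σ.ideal (p + 1)).carrier

/-! ### Rees matrix semigroups -/

/-- The underlying set of the Rees matrix semigroup `𝓜⁰(G, n, m; P)`, with zero `θ` and nonzero
elements `(g; i, j)`, where `P` is an `m × n` matrix over `G` with a zero adjoined. -/
inductive Rees {G : Type v} {n m : ℕ} (P : Matrix (Fin m) (Fin n) (WithZero G)) : Type v
  | theta : Rees P
  | elt (g : G) (i : Fin n) (j : Fin m) : Rees P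

namespace Rees

variable {G : Type v} {n m : ℕ} {P : Matrix (Fin m) (Fin n) (WithZero G)}

/-- `(w; i, j)` for `w` in `G` with a zero adjoined, where `(0; i, j) = θ`. -/
def ofEntry (P : Matrix (Fin m) (Fin n) (WithZero G)) (w : WithZero G) (i : Fin n) (j : Fin m) :
    Rees P :=
  WithZero.recZeroCoe theta (fun g => elt g i j) w

/-- `(g; i, j)(h; k, l) = (g p_{jk} h; i, l)` if `p_{jk} ≠ 0`, and all other products are `θ`. -/
def mul [Group G] : Rees P → Rees P → Rees P
  | elt g i j, elt h k l => ofEntry P ((g : WithZero G) * P j k * (h : WithZero G)) i l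
  | theta, _ => theta
  | elt _ _ _, theta => theta

instance [Group G] : Mul (Rees P) := ⟨mul⟩

theorem theta_mul [Group G] (x : Rees P) : (theta : Rees P) * x = theta := rfl

theorem mul_theta [Group G] (x : Rees P) : x * (theta : Rees P) = theta := by
  cases x <;> rfl

theorem elt_mul_elt [Group G] (g h : G) (i k : Fin n) (j l : Fin m) :
    (elt g i j : Rees P) * elt h k l = ofEntry P ((g : WithZero G) * P j k * h) i l := rfl

theorem ofEntry_mul_elt [Group G] (w : WithZero G) (h : G) (i k : Fin n) (j l : Fin m) :
    ofEntry P w i j * elt h k l = ofEntry P (w * P j k * h) i l := by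
  induction w using WithZero.recZeroCoe with
  | zero => simp [ofEntry, theta_mul]
  | coe g => rfl

theorem elt_mul_ofEntry [Group G] (w : WithZero G) (g : G) (i k : Fin n) (j l : Fin m) :
    (elt g i j : Rees P) * ofEntry P w k l = ofEntry P (g * P j k * w) i l := by
  induction w using WithZero.recZeroCoe with
  | zero => simp [ofEntry, mul_theta]
  | coe h => rfl

instance [Group G] : Semigroup (Rees P) where
  mul_assoc x y z := by
    cases x <;> cases y <;> cases z <;>
      simp only [theta_mul, mul_theta, elt_mul_elt, ofEntry_mul_elt, elt_mul_ofEntry, mul_assoc]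

end Rees

/-- `P` is the sandwich matrix of a regular (every row and every column has a nonzero entry)
`CS`-diagonal Rees matrix semigroup: if `p_{r,t}`, `p_{r',t}`, `p_{r,t'}` are nonzero, then so is
`p_{r',t'}`. -/
structure IsCSDiagonal {G : Type v} {n m : ℕ} (P : Matrix (Fin m) (Fin n) (WithZero G)) : Prop where
  row : ∀ j, ∃ i, P j i ≠ 0
  col : ∀ i, ∃ j, P j i ≠ 0
  diag : ∀ r r' t t', P r t ≠ 0 → P r' t ≠ 0 → P r t' ≠ 0 → P r' t' ≠ 0

/-- Two elements of `{1, …, n}` are equivalent iff some row of `P` is nonzero at both. -/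
def IsCSDiagonal.setoid {G : Type v} {n m : ℕ} {P : Matrix (Fin m) (Fin n) (WithZero G)}
    (hP : IsCSDiagonal P) : Setoid (Fin n) where
  r i i' := ∃ j, P j i ≠ 0 ∧ P j i' ≠ 0
  iseqv :=
    { refl := fun i => (hP.col i).imp fun _ h => ⟨h, h⟩
      symm := fun ⟨j, h₁, h₂⟩ => ⟨j, h₂, h₁⟩
      trans := fun ⟨j, h₁, h₂⟩ ⟨j', h₃, h₄⟩ => ⟨j, h₁, hP.diag j' j _ _ h₃ h₂ h₄⟩ }

/-- The set of the classes `𝕀_1, …, 𝕀_{n_{η*}}` of `{1, …, n}`. -/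
abbrev IsCSDiagonal.Class {G : Type v} {n m : ℕ} {P : Matrix (Fin m) (Fin n) (WithZero G)}
    (hP : IsCSDiagonal P) : Type :=
  Quotient hP.setoid

/-- The class of `i ∈ {1, …, n}`. -/
def IsCSDiagonal.cls {G : Type v} {n m : ℕ} {P : Matrix (Fin m) (Fin n) (WithZero G)}
    (hP : IsCSDiagonal P) (i : Fin n) : hP.Class :=
  Quotient.mk hP.setoid i

/-- `j ∈ 𝕀'_k`: the entry `p_{j,i}` is nonzero for some `i ∈ 𝕀_k`. -/
def IsCSDiagonal.RowMem {G : Type v} {n m : ℕ} {P : Matrix (Fin m) (Fin n) (WithZero G)}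
    (hP : IsCSDiagonal P) (j : Fin m) (k : hP.Class) : Prop :=
  ∃ i, hP.cls i = k ∧ P j i ≠ 0

/-- An isomorphism of the factor `A / B` with a Rees matrix semigroup: with `𝓜⁰(G, n, m; P)` if `B` is
nonempty, and with its set `𝓜(G, n, m; P)` of nonzero elements (which is then closed under
products) if `B` is empty. -/
structure ReesIso {S : Type u} [Semigroup S] (A B : SgIdeal S) {G : Type v} [Group G] {n m : ℕ}
    (P : Matrix (Fin m) (Fin n) (WithZero G)) where
  hom : factor A B →ₙ* Rees P
  injective : Function.Injective hom
  range : ∀ y : Rees P, y ∈ Set.range hom ↔ (y = Rees.theta → B.carrier.Nonempty)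

/-- `x ∈ S` is the element `(g; i, j)` of `A ∖ B`. -/
def ReesIso.IsElt {S : Type u} [Semigroup S] {A B : SgIdeal S} {G : Type v} [Group G] {n m : ℕ}
    {P : Matrix (Fin m) (Fin n) (WithZero G)} (E : ReesIso A B P)
    (x : S) (g : G) (i : Fin n) (j : Fin m) : Prop :=
  ∃ hx : x ∈ A.carrier, E.hom (factor.mk B x hx) = Rees.elt g i j

/-! ### The minimal non-nilpotent representation -/

/-- For `s ∈ S / B`: `s (g; α, β) = (g'; α', β)` for some `g, g'`, `β`, `α ∈ 𝕀_k`, `α' ∈ 𝕀_{k'}`. -/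
def GammaRel {S : Type u} [Semigroup S] {A B : SgIdeal S} {G : Type v} [Group G] {n m : ℕ}
    {P : Matrix (Fin m) (Fin n) (WithZero G)} (hP : IsCSDiagonal P) (E : ReesIso A B P)
    (s : B.ReesQuotient) (k k' : hP.Class) : Prop :=
  ∃ (x y : factor A B) (g g' : G) (α α' : Fin n) (β : Fin m),
    E.hom x = Rees.elt g α β ∧ E.hom y = Rees.elt g' α' β ∧ hP.cls α = k ∧ hP.cls α' = k' ∧
      s * (x : B.ReesQuotient) = (y : B.ReesQuotient)

open Classical in
/-- The minimal non-nilpotent representation `Γ` of `S / B` by transformations of the set of the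
classes together with `θ` (here `none`): `Γ(s)(k) = k'` if `s (g; α, β) = (g'; α', β)` for some
`α ∈ 𝕀_k` and `α' ∈ 𝕀_{k'}`, and `Γ(s)(k) = θ` if there is no such `k'`; `Γ(s)(θ) = θ`. (There is at
most one such `k'`.) -/
noncomputable def Gamma {S : Type u} [Semigroup S] {A B : SgIdeal S} {G : Type v} [Group G]
    {n m : ℕ} {P : Matrix (Fin m) (Fin n) (WithZero G)} (hP : IsCSDiagonal P) (E : ReesIso A B P)
    (s : B.ReesQuotient) : Option hP.Class → Option hP.Class
  | none => none
  | some k => if h : ∃ k', GammaRel hP E s k k' then some h.choose else none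

/-- `[…, i₁, i₁', …, i₂, i₂', …] ⊑ f`. -/
def OrbitLE {K : Type w} (i₁ i₁' i₂ i₂' : K) (f : Option K → Option K) : Prop :=
  f (some i₁) = some i₁' ∧ f (some i₂) = some i₂'

/-! ### The `η*`-root -/

/-- `θ` is the `η*`-root of `S_p / S_{p+1}`: `S` has a zero `θ`, and some element of
`S_p ∖ S_{p+1}` is `η*`-related to it. -/
def ThetaIsRoot {S : Type u} [Semigroup S] (σ : PrincipalSeries S) (p : ℕ) : Prop :=
  ∃ θ : S, IsZeroElt θ ∧ ∃ a ∈ σ.layer p, etaStar S a θ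

/-- `S_{p'} / S_{p'+1}` is the `η*`-root of the factor `S_p / S_{p+1}`, which is a Rees matrix
semigroup through `E` and has an element that is not `η*`-related to `θ` (if `S` has a zero). -/
structure IsEtaRoot {S : Type u} [Semigroup S] (σ : PrincipalSeries S) {p : ℕ}
    {G : Type v} [Group G] {n m : ℕ} {P : Matrix (Fin m) (Fin n) (WithZero G)}
    (E : ReesIso (σ.ideal p) (σ.ideal (p + 1)) P) (p' : ℕ) : Prop where
  not_theta : ∃ a ∈ σ.layer p, ∀ θ : S, IsZeroElt θ → ¬ etaStar S a θ
  le : p ≤ p'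
  le_o : p' ≤ σ.o
  /-- every element of `S_p ∖ S_{p+1}` is related to one of `S_{p'} ∖ S_{p'+1}` -/
  related : ∀ x ∈ σ.layer p, ∃ y ∈ σ.layer p', etaStar S x y
  /-- no element of either layer is related to an element of `S_{p'+1}` -/
  not_related : ∀ z ∈ σ.layer p ∪ σ.layer p', ∀ z' ∈ (σ.ideal (p' + 1)).carrier,
    ¬ etaStar S z z'
  /-- `S_{p'} / S_{p'+1}` is a `CS`-diagonal regular Rees matrix semigroup -/
  csDiagonal : ∃ (H : Type u) (_ : Group H) (n' m' : ℕ)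
    (Q : Matrix (Fin m') (Fin n') (WithZero H)),
      IsCSDiagonal Q ∧ Nonempty (ReesIso (σ.ideal p') (σ.ideal (p' + 1)) Q)
  /-- nonzero products correspond to matching classes, in all coordinates of the root -/
  matching : ∀ (H : Type u) [Group H] (n' m' : ℕ) (Q : Matrix (Fin m') (Fin n') (WithZero H))
    (hQ : IsCSDiagonal Q) (F : ReesIso (σ.ideal p') (σ.ideal (p' + 1)) Q)
    (x₁ x₂ y₁ y₂ : S) (g g' : G) (α γ : Fin n) (β δ : Fin m)
    (h h' : H) (i k : Fin n') (j l : Fin m'),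
      E.IsElt x₁ g α β → E.IsElt x₂ g' γ δ → P β γ ≠ 0 →
      F.IsElt y₁ h i j → F.IsElt y₂ h' k l → etaStar S x₁ y₁ → etaStar S x₂ y₂ →
        ∃ r : hQ.Class, hQ.cls k = r ∧ hQ.RowMem j r

/-- `φ` is the function `φ_{η*}` from `{1, …, n}` to the classes of `{1, …, n'}`: `φ_{η*}(α) = 𝕀_r`
iff some `(g; α, β)` is `η*`-related to some `(h; i, j)` with `i ∈ 𝕀_r`. -/
def IsPhi {S : Type u} [Semigroup S] {A B A' B' : SgIdeal S}
    {G : Type v} [Group G] {n m : ℕ} {P : Matrix (Fin m) (Fin n) (WithZero G)}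
    (E : ReesIso A B P)
    {H : Type w} [Group H] {n' m' : ℕ} {Q : Matrix (Fin m') (Fin n') (WithZero H)}
    (hQ : IsCSDiagonal Q) (F : ReesIso A' B' Q) (φ : Fin n → hQ.Class) : Prop :=
  ∀ (α : Fin n) (r : hQ.Class), φ α = r ↔
    ∃ (x y : S) (g : G) (β : Fin m) (h : H) (i : Fin n') (j : Fin m'),
      E.IsElt x g α β ∧ F.IsElt y h i j ∧ etaStar S x y ∧ hQ.cls i = r

end EtaStar

namespace EtaStar

/-! ### Finite semigroups -/

/-! Assume `θ` is not the root, and let `q` be the last index for which `S_q` contains an element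
`η*`-related to one of `S_p ∖ S_{p+1}` (`PrincipalSeries.exists_last`). Each layer lies in one
`𝓙`-class, so multiplying a single related pair on both sides relates the whole layer `p` to layer
`q`, and neither layer is related to anything in `S_{q+1}`.

The engine is `exists_etaStar_malcev`: by finiteness a Malcev sequence of pairs repeats, so its two
entries become `η*`-related. It is used twice.

Within a layer, if `w a` and `w b` both stay in the `𝓙`-class of `w` and `a`, then `a` lies in `b S`
modulo `η*` (`IsJClass.exists_etaStar_mul`). Hence columns of a sandwich matrix sharing a nonzero
row are `𝓡`-comparable modulo `η*`. Since nothing in layer `q` collapses into `S_{q+1}`, this makes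
that layer CS-diagonal, once an idempotent carried over from layer `p` has given it Rees coordinates
(`exists_reesIso`). So layer `q` is the root (`isEtaRoot_of_related`), and `φ` is well defined and
constant on classes (`exists_isPhi`).

For the swap, a Malcev sequence with `v₂` and `v₁` inserted alternately never leaves layer `p`, and
its entries keep their first indices, in `k₁` and `k₃` (`exists_etaStar_of_gammaRel`). So some
elements over `k₁` and `k₃` are related, and left multiplication by `v₁` gives the same for `k₂` and
`k₄`. This yields the equalities of `φ`. If `q = p`, then `φ` is the class map itself, which would
force `k₁ = k₃`. -/

theorem exists_pow_idempotent {M : Type*} [Monoid M] [Finite M] (x : M) :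
    ∃ n, x ^ (n + 1) * x ^ (n + 1) = x ^ (n + 1) := by
  obtain ⟨i, j, hij, h⟩ : ∃ i j : ℕ, i < j ∧ x ^ i = x ^ j := by
    obtain ⟨i, j, hne, h⟩ := Finite.exists_ne_map_eq_of_infinite fun k : ℕ => x ^ k
    rcases lt_or_gt_of_ne hne with hlt | hlt
    · exact ⟨i, j, hlt, h⟩
    · exact ⟨j, i, hlt, h.symm⟩
  obtain ⟨d, rfl⟩ : ∃ d, j = i + (d + 1) := ⟨j - i - 1, by omega⟩
  have hstep : ∀ k, x ^ (i + k) = x ^ (i + k + (d + 1)) := fun k => by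
    rw [pow_add, h, ← pow_add]
    congr 1
    omega
  have hmul : ∀ m k, x ^ (i + k) = x ^ (i + k + m * (d + 1)) := by
    intro m
    induction m with
    | zero => intro k; simp
    | succ m ih =>
      intro k
      rw [ih k, add_assoc i k, hstep]
      congr 1
      ring
  -- The exponent is a positive multiple of the period `d + 1` that is at least the preperiod `i`,
  -- so doubling it changes nothing.
  refine ⟨(i + 1) * (d + 1) - 1, ?_⟩
  have hpos : (i + 1) * (d + 1) - 1 + 1 = (i + 1) * (d + 1) :=
    Nat.sub_add_cancel (Nat.mul_pos i.succ_pos d.succ_pos)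
  rw [hpos, ← pow_add]
  obtain ⟨k, hk⟩ : ∃ k, (i + 1) * (d + 1) = i + k := by
    refine Nat.exists_eq_add_of_le ?_
    nlinarith
  conv_rhs => rw [hk, hmul (i + 1) k, ← hk]

/-- If `a = u a v` in a finite monoid, then right multiplication by some power of `v` fixes `a`. -/
theorem eq_mul_pow_of_eq_mul_mul {M : Type*} [Monoid M] [Finite M] {a u v : M}
    (h : a = u * a * v) : ∃ n, a = a * v ^ (n + 1) := by
  have hpow : ∀ n, a = u ^ n * a * v ^ n := by
    intro n
    induction n with
    | zero => simp
    | succ n ih =>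
      calc a = u ^ n * a * v ^ n := ih
        _ = u ^ n * (u * a * v) * v ^ n := by rw [← h]
        _ = u ^ (n + 1) * a * v ^ (n + 1) := by rw [pow_succ u, pow_succ' v]; simp only [mul_assoc]
  obtain ⟨n, hn⟩ := exists_pow_idempotent v
  refine ⟨n, ?_⟩
  conv_lhs => rw [hpow (n + 1), ← hn]
  rw [← mul_assoc, ← hpow]

theorem eq_pow_mul_of_eq_mul_mul {M : Type*} [Monoid M] [Finite M] {a u v : M}
    (h : a = u * a * v) : ∃ n, a = u ^ (n + 1) * a := by
  have : Finite Mᵐᵒᵖ := Finite.of_equiv M MulOpposite.opEquiv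
  have h' : MulOpposite.op a = MulOpposite.op v * MulOpposite.op a * MulOpposite.op u := by
    rw [← MulOpposite.op_mul, ← MulOpposite.op_mul, ← mul_assoc, ← h]
  obtain ⟨n, hn⟩ := eq_mul_pow_of_eq_mul_mul h'
  refine ⟨n, MulOpposite.op_injective ?_⟩
  rw [MulOpposite.op_mul, MulOpposite.op_pow]
  exact hn

instance {S : Type u} [Finite S] : Finite (WithOne S) :=
  inferInstanceAs (Finite (Option S))

/-! ### `𝓙`-classes of a principal series and stability -/

section Sandwich

variable {S : Type u} [Semigroup S]

/-- The product `u c v` in `S`, for `u`, `v` in `S¹`. -/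
def sandwich (s t : WithOne S) (c : S) : S :=
  match s, t with
  | none, none => c
  | some s, none => s * c
  | none, some t => c * t
  | some s, some t => s * c * t

theorem coe_sandwich (s t : WithOne S) (c : S) : ((sandwich s t c : S) : WithOne S) = s * (c : WithOne S) * t := by
  cases s <;> cases t <;> rfl

theorem etaStar_sandwich (s t : WithOne S) {x y : S} (h : etaStar S x y) :
    etaStar S (sandwich s t x) (sandwich s t y) := by
  rcases s with _ | s <;> rcases t with _ | t
  · exact h
  · exact (etaStar S).mul h ((etaStar S).refl t)
  · exact (etaStar S).mul ((etaStar S).refl s) h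
  · exact (etaStar S).mul ((etaStar S).mul ((etaStar S).refl s) h) ((etaStar S).refl t)

theorem SgIdeal.sandwich_mem (A : SgIdeal S) (s t : WithOne S) {x : S} (h : x ∈ A.carrier) :
    sandwich s t x ∈ A.carrier := by
  rcases s with _ | s <;> rcases t with _ | t
  · exact h
  · exact A.mul_right_mem _ _ h
  · exact A.mul_left_mem _ _ h
  · exact A.mul_right_mem _ _ (A.mul_left_mem _ _ h)

/-- The difference `A ∖ B` of two ideals is contained in a `𝓙`-class. -/
def IsJClass (A B : SgIdeal S) : Prop :=
  ∀ a b : S, a ∈ A.carrier \ B.carrier → b ∈ A.carrier \ B.carrier →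
    ∃ s t : WithOne S, b = sandwich s t a

/-- Stability of finite semigroups: in a `𝓙`-class, going down by right multiplication without
leaving the class can be undone by right multiplication. -/
theorem IsJClass.exists_mul_right [Finite S] {A B : SgIdeal S} (hJ : IsJClass A B) {a c : S}
    (ha : a ∈ A.carrier \ B.carrier) (hac : a * c ∉ B.carrier) : ∃ d, a = a * c * d := by
  obtain ⟨s, t, h⟩ := hJ (a * c) a ⟨A.mul_right_mem _ _ ha.1, hac⟩ ha
  have h' : (a : WithOne S) = s * a * (c * t) := by
    conv_lhs => rw [h, coe_sandwich, WithOne.coe_mul]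
    simp only [mul_assoc]
  obtain ⟨n, hn⟩ := eq_mul_pow_of_eq_mul_mul h'
  -- The multiplier must lie in `S`, not just in `S¹`, although `t` may be `1`. Using the power of
  -- `c t` twice puts a factor `c` in the middle.
  refine ⟨sandwich (t * (c * t) ^ n) (t * (c * t) ^ n) c, WithOne.coe_injective ?_⟩
  rw [WithOne.coe_mul, coe_sandwich, WithOne.coe_mul]
  calc (a : WithOne S) = a * (c * t) ^ (n + 1) * (c * t) ^ (n + 1) := by rw [← hn, ← hn]
    _ = _ := by rw [pow_succ']; simp only [mul_assoc]

theorem IsJClass.exists_mul_left [Finite S] {A B : SgIdeal S} (hJ : IsJClass A B) {a c : S}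
    (ha : a ∈ A.carrier \ B.carrier) (hac : c * a ∉ B.carrier) : ∃ d, a = d * (c * a) := by
  obtain ⟨s, t, h⟩ := hJ (c * a) a ⟨A.mul_left_mem _ _ ha.1, hac⟩ ha
  have h' : (a : WithOne S) = (s * c) * a * t := by
    conv_lhs => rw [h, coe_sandwich, WithOne.coe_mul]
    simp only [mul_assoc]
  obtain ⟨n, hn⟩ := eq_pow_mul_of_eq_mul_mul h'
  refine ⟨sandwich ((s * c) ^ n * s) ((s * c) ^ n * s) c, WithOne.coe_injective ?_⟩
  rw [WithOne.coe_mul, coe_sandwich, WithOne.coe_mul]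
  calc (a : WithOne S) = (s * c) ^ (n + 1) * ((s * c) ^ (n + 1) * a) := by rw [← hn, ← hn]
    _ = _ := by rw [pow_succ]; simp only [mul_assoc]

/-- The union of `S_{p+1}` and `S¹ a S¹` is an ideal between `S_{p+1}` and `S_p` containing `a`,
hence all of `S_p`. -/
theorem PrincipalSeries.isJClass (σ : PrincipalSeries S) {p : ℕ} (hp : 1 ≤ p) (hpo : p ≤ σ.o) :
    IsJClass (σ.ideal p) (σ.ideal (p + 1)) := by
  intro a b ha hb
  let I : SgIdeal S :=
    { carrier := {x | x ∈ (σ.ideal (p + 1)).carrier ∨ ∃ s t : WithOne S, x = sandwich s t a}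
      mul_left_mem := by
        rintro c x (hx | ⟨s, t, rfl⟩)
        · exact Or.inl ((σ.ideal (p + 1)).mul_left_mem _ _ hx)
        · refine Or.inr ⟨c * s, t, WithOne.coe_injective ?_⟩
          simp only [WithOne.coe_mul, coe_sandwich, mul_assoc]
      mul_right_mem := by
        rintro c x (hx | ⟨s, t, rfl⟩)
        · exact Or.inl ((σ.ideal (p + 1)).mul_right_mem _ _ hx)
        · refine Or.inr ⟨s, t * c, WithOne.coe_injective ?_⟩
          simp only [WithOne.coe_mul, coe_sandwich, mul_assoc] }
  have haI : a ∈ I.carrier := Or.inr ⟨1, 1, rfl⟩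
  rcases σ.no_between p hp hpo I (fun x hx => Or.inl hx) (by
    rintro x (hx | ⟨s, t, rfl⟩)
    · exact (σ.strict p hp hpo).1 hx
    · exact SgIdeal.sandwich_mem _ _ _ ha.1) with h | h
  · exact absurd (h ▸ haI) ha.2
  · have hbI : b ∈ I.carrier := h ▸ hb.1
    exact hbI.resolve_left hb.2

end Sandwich

/-! ### Malcev sequences -/

section Malcev

theorem malcev_coe {S : Type u} [Semigroup S] (x y : S) (z : ℕ → S) (n : ℕ) :
    malcev (x : WithOne S) (y : WithOne S) (fun k => (z k : WithOne S)) n =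
      (((malcev x y z n).1 : WithOne S), ((malcev x y z n).2 : WithOne S)) := by
  induction n with
  | zero => rfl
  | succ n ih => simp only [malcev, ih, WithOne.coe_mul]

theorem malcev_add {M : Type u} [Mul M] (x y : M) (z : ℕ → M) (i n : ℕ) :
    malcev x y z (i + n) =
      malcev (malcev x y z i).1 (malcev x y z i).2 (fun k => z (i + k)) n := by
  induction n with
  | zero => rfl
  | succ n ih => rw [← add_assoc, malcev, malcev, ih, add_assoc]

/-- In a finite semigroup, the two Malcev sequences meet modulo `η*`. -/
theorem exists_etaStar_malcev {S : Type u} [Semigroup S] [Finite S] (x y : S) (z : ℕ → S) :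
    ∃ n, etaStar S (malcev x y z n).1 (malcev x y z n).2 := by
  -- Comparing only even indices makes the gap at least 2, as `etaN` requires for a nontrivial
  -- relation.
  obtain ⟨i, j, hij, h⟩ : ∃ i j : ℕ, i < j ∧ malcev x y z (2 * i) = malcev x y z (2 * j) := by
    obtain ⟨i, j, hne, h⟩ := Finite.exists_ne_map_eq_of_infinite fun k : ℕ => malcev x y z (2 * k)
    rcases lt_or_gt_of_ne hne with hlt | hlt
    · exact ⟨i, j, hlt, h⟩
    · exact ⟨j, i, hlt, h.symm⟩
  obtain ⟨d, hd⟩ : ∃ d, 2 * j = 2 * i + d := ⟨2 * j - 2 * i, by omega⟩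
  refine ⟨2 * i, ConGen.Rel.of _ _ (Relation.TransGen.single ⟨d, by omega, Or.inr ⟨by omega,
    fun k => (z (2 * i + k) : WithOne S), ?_⟩⟩)⟩
  rw [hd, malcev_add] at h
  rw [malcev_coe _ _ (fun k => z (2 * i + k)), ← h]

theorem malcev_fst_eq_mul {S : Type u} [Semigroup S] (a b s t : S) (z : ℕ → S) (n : ℕ) :
    (∃ d, (malcev (a * s) (b * t) z n).1 = a * d) ∧
      ∃ d, (malcev (a * s) (b * t) z n).2 = b * d := by
  induction n with
  | zero => exact ⟨⟨s, rfl⟩, t, rfl⟩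
  | succ n ih =>
    obtain ⟨⟨d, hd⟩, d', hd'⟩ := ih
    simp only [malcev, hd, hd', mul_assoc]
    exact ⟨⟨_, rfl⟩, _, rfl⟩

theorem mul_malcev_eq {S : Type u} [Semigroup S] {w x y : S} (hx : w * x = w) (hy : w * y = w)
    (n : ℕ) : w * (malcev x y (fun _ => x) n).1 = w ∧ w * (malcev x y (fun _ => x) n).2 = w := by
  induction n with
  | zero => exact ⟨hx, hy⟩
  | succ n ih => simp only [malcev, ← mul_assoc, ih.1, ih.2, hx, and_self]

/-- If `w a` and `w b` are in the same `𝓙`-class as `w`, `a` and `b`, then `a` and `b` are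
`𝓡`-related modulo `η*`. -/
theorem IsJClass.exists_etaStar_mul {S : Type u} [Semigroup S] [Finite S] {A B : SgIdeal S}
    (hJ : IsJClass A B) {w a b : S} (hw : w ∈ A.carrier \ B.carrier)
    (ha : a ∈ A.carrier \ B.carrier)
    (hwa : w * a ∉ B.carrier) (hwb : w * b ∉ B.carrier) : ∃ c, etaStar S a (b * c) := by
  obtain ⟨s, hs⟩ := hJ.exists_mul_right hw hwa
  obtain ⟨t, ht⟩ := hJ.exists_mul_right hw hwb
  -- Both `a s` and `b t` fix `w` from the right, so every term of their Malcev sequence does. The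
  -- terms therefore avoid `B`, and stability recovers `a` from the left term.
  obtain ⟨n, hn⟩ := exists_etaStar_malcev (a * s) (b * t) fun _ => a * s
  have hfix := mul_malcev_eq (w := w) (x := a * s) (y := b * t)
    (by rw [← mul_assoc, ← hs]) (by rw [← mul_assoc, ← ht]) n
  obtain ⟨⟨c, hc⟩, c', hc'⟩ := malcev_fst_eq_mul a b s t (fun _ => a * s) n
  rw [hc, hc'] at hn
  have hac : a * c ∉ B.carrier := fun h => by
    apply hw.2
    rw [← hfix.1, hc]
    exact B.mul_left_mem _ _ h
  obtain ⟨d, hd⟩ := hJ.exists_mul_right ha hac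
  refine ⟨c' * d, ?_⟩
  rw [← mul_assoc]
  conv => arg 2; rw [hd]
  exact (etaStar S).mul hn ((etaStar S).refl d)

end Malcev

/-! ### Rees coordinates -/

namespace ReesIso

variable {S : Type u} [Semigroup S] {A B : SgIdeal S} {G : Type v} [Group G] {n m : ℕ}
  {P : Matrix (Fin m) (Fin n) (WithZero G)} (E : ReesIso A B P)

/-- `x ∈ S` is the element `(g; i, j)` of `A ∖ B`, for some `g`. -/
def IsAt (x : S) (i : Fin n) (j : Fin m) : Prop :=
  ∃ g, E.IsElt x g i j

theorem hom_mk_of_mem {x : S} (hxA : x ∈ A.carrier) (hx : x ∈ B.carrier) :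
    E.hom (factor.mk B x hxA) = Rees.theta := by
  obtain ⟨⟨_, y, hy, rfl⟩, hc⟩ := (E.range Rees.theta).2 fun _ => ⟨x, hx⟩
  have h : factor.mk B x hxA * factor.mk B y hy = factor.mk B x hxA :=
    Subtype.ext ((Con.eq _).2 (Or.inr ⟨B.mul_right_mem _ _ hx, hx⟩))
  rw [← h, map_mul]
  exact (congrArg _ hc).trans (Rees.mul_theta _)

variable {E}

theorem IsElt.mem {x : S} {g : G} {i : Fin n} {j : Fin m} (h : E.IsElt x g i j) :
    x ∈ A.carrier \ B.carrier := by
  obtain ⟨hx, h⟩ := h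
  refine ⟨hx, fun hB => ?_⟩
  rw [E.hom_mk_of_mem hx hB] at h
  cases h

theorem IsAt.mem {x : S} {i : Fin n} {j : Fin m} (h : E.IsAt x i j) :
    x ∈ A.carrier \ B.carrier :=
  h.choose_spec.mem

theorem exists_isAt (E : ReesIso A B P) {x : S} (hx : x ∈ A.carrier \ B.carrier) :
    ∃ i j, E.IsAt x i j := by
  rcases h : E.hom (factor.mk B x hx.1) with _ | ⟨g, i, j⟩
  · obtain ⟨b, hb⟩ := (E.range Rees.theta).1 ⟨_, h⟩ rfl
    -- The product `b x` is used rather than `b` because `B ⊆ A` is not assumed.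
    have hb' : b * x ∈ B.carrier := B.mul_right_mem _ _ hb
    have hA : b * x ∈ A.carrier := A.mul_left_mem _ _ hx.1
    have h' := congrArg Subtype.val (E.injective (h.trans (E.hom_mk_of_mem hA hb').symm))
    rcases (Con.eq _).1 h' with h' | h'
    · exact absurd (h' ▸ hb') hx.2
    · exact absurd h'.1 hx.2
  · exact ⟨i, j, g, hx.1, h⟩

theorem exists_isElt (E : ReesIso A B P) (g : G) (i : Fin n) (j : Fin m) :
    ∃ x, E.IsElt x g i j := by
  obtain ⟨⟨_, y, hy, rfl⟩, hc⟩ := (E.range (Rees.elt g i j)).2 fun h => by cases h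
  exact ⟨y, hy, hc⟩

theorem IsElt.hom_mul {x y : S} {g h : G} {i k : Fin n} {j l : Fin m} (hx : E.IsElt x g i j)
    (hy : E.IsElt y h k l) (hxy : x * y ∈ A.carrier) :
    E.hom (factor.mk B (x * y) hxy) = Rees.ofEntry P ((g : WithZero G) * P j k * h) i l := by
  obtain ⟨hx', hx⟩ := hx
  obtain ⟨hy', hy⟩ := hy
  have : factor.mk B (x * y) hxy = factor.mk B x hx' * factor.mk B y hy' := rfl
  rw [this, map_mul, hx, hy, Rees.elt_mul_elt]

theorem IsAt.mul {x y : S} {i k : Fin n} {j l : Fin m} (hx : E.IsAt x i j)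
    (hy : E.IsAt y k l) (hP : P j k ≠ 0) : E.IsAt (x * y) i l := by
  obtain ⟨g, hx⟩ := hx
  obtain ⟨h, hy⟩ := hy
  obtain ⟨p, hp⟩ := WithZero.ne_zero_iff_exists.1 hP
  refine ⟨g * p * h, A.mul_left_mem _ _ hy.mem.1, ?_⟩
  rw [hx.hom_mul hy, ← hp]
  rfl

theorem IsAt.mul_notMem_iff {x y : S} {i k : Fin n} {j l : Fin m} (hx : E.IsAt x i j)
    (hy : E.IsAt y k l) : x * y ∉ B.carrier ↔ P j k ≠ 0 := by
  refine ⟨fun hxy hP => ?_, fun hP => (hx.mul hy hP).mem.2⟩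
  obtain ⟨g, hx⟩ := hx
  obtain ⟨h, hy⟩ := hy
  have hA : x * y ∈ A.carrier := A.mul_left_mem _ _ hy.mem.1
  obtain ⟨i', j', g', _, hE⟩ := E.exists_isAt ⟨hA, hxy⟩
  have := (hx.hom_mul hy hA).symm.trans hE
  rw [hP, mul_zero, zero_mul] at this
  cases this

theorem exists_isAt_coords (E : ReesIso A B P) (i : Fin n) (j : Fin m) : ∃ x, E.IsAt x i j := by
  obtain ⟨x, hx⟩ := E.exists_isElt 1 i j
  exact ⟨x, 1, hx⟩

end ReesIso

/-- By CS-diagonality, whether an entry of a row vanishes depends only on the class of its column.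
-/
theorem IsCSDiagonal.rowMem_iff {G : Type v} {n m : ℕ} {P : Matrix (Fin m) (Fin n) (WithZero G)}
    (hP : IsCSDiagonal P) (j : Fin m) (i : Fin n) : hP.RowMem j (hP.cls i) ↔ P j i ≠ 0 := by
  refine ⟨?_, fun h => ⟨i, rfl, h⟩⟩
  rintro ⟨i', h, hj⟩
  obtain ⟨j', h₁, h₂⟩ : ∃ j', P j' i' ≠ 0 ∧ P j' i ≠ 0 := Quotient.exact h
  exact hP.diag j' j _ _ h₁ hj h₂

/-! ### The Rees theorem for finite regular `𝓙`-classes -/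

theorem exists_transversal {X : Type u} [Finite X] (r : Setoid X) :
    ∃ (n : ℕ) (q : Fin n → X), (∀ x, ∃ i, r (q i) x) ∧ ∀ i k, r (q i) (q k) → i = k := by
  obtain ⟨n, ⟨f⟩⟩ := Finite.exists_equiv_fin (Quotient r)
  refine ⟨n, fun i => (f.symm i).out, fun x => ⟨f ⟦x⟧, ?_⟩, fun i k h => ?_⟩
  · simp only [Equiv.symm_apply_apply]
    exact Quotient.mk_out x
  · apply f.symm.injective
    rw [← Quotient.out_eq (f.symm i), ← Quotient.out_eq (f.symm k)]
    exact Quotient.sound h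

section ReesTheorem

variable {S : Type u} [Semigroup S]

/-- The elements of the `𝓙`-class `A ∖ B` that are fixed by right multiplication by `e`. -/
def LClass (A B : SgIdeal S) (e : S) : Set S :=
  {x | x ∈ A.carrier \ B.carrier ∧ x * e = x}

/-- The elements of the `𝓙`-class `A ∖ B` that are fixed by left multiplication by `e`. -/
def RClass (A B : SgIdeal S) (e : S) : Set S :=
  {x | x ∈ A.carrier \ B.carrier ∧ e * x = x}

/-- The maximal subgroup of the idempotent `e` of the `𝓙`-class `A ∖ B`. -/
@[ext]
structure HClass (A B : SgIdeal S) (e : S) : Type u where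
  val : S
  memL : val ∈ LClass A B e
  memR : val ∈ RClass A B e

variable {A B : SgIdeal S} {e : S}

/-- By stability, being fixed by `e` on the right already means being `𝓛`-related to `e`. -/
theorem exists_mul_eq_of_mem_LClass
    [Finite S] (hJ : IsJClass A B) (he : e ∈ A.carrier \ B.carrier) {q : S} (hq : q ∈ LClass A B e) : ∃ u, u * q = e := by
  obtain ⟨d, hd⟩ := hJ.exists_mul_left he (c := q) (by rw [hq.2]; exact hq.1.2)
  rw [hq.2] at hd
  exact ⟨d, hd.symm⟩

theorem exists_mul_eq_of_mem_RClass
    [Finite S] (hJ : IsJClass A B) (he : e ∈ A.carrier \ B.carrier) {r : S} (hr : r ∈ RClass A B e) : ∃ u, r * u = e := by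
  obtain ⟨d, hd⟩ := hJ.exists_mul_right he (c := r) (by rw [hr.2]; exact hr.1.2)
  rw [hr.2] at hd
  exact ⟨d, hd.symm⟩

theorem mul_mem_of_mem_classes
    [Finite S] (hJ : IsJClass A B) (he : e ∈ A.carrier \ B.carrier) (hee : e * e = e) {q r : S} (hq : q ∈ LClass A B e) (hr : r ∈ RClass A B e) :
    q * r ∈ A.carrier \ B.carrier := by
  obtain ⟨u, hu⟩ := exists_mul_eq_of_mem_LClass hJ he hq
  obtain ⟨v, hv⟩ := exists_mul_eq_of_mem_RClass hJ he hr
  refine ⟨A.mul_left_mem _ _ hr.1.1, fun h => he.2 ?_⟩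
  have : u * (q * r) * v = e := by
    rw [← mul_assoc, hu, mul_assoc, hv, hee]
  rw [← this]
  exact B.mul_right_mem _ _ (B.mul_left_mem _ _ h)

theorem exists_eq_mul_of_mem
    (hJ : IsJClass A B) (he : e ∈ A.carrier \ B.carrier) (hee : e * e = e) {a : S} (ha : a ∈ A.carrier \ B.carrier) :
    ∃ q ∈ LClass A B e, ∃ r ∈ RClass A B e, a = q * r := by
  obtain ⟨s, t, h⟩ := hJ e a he ha
  have h' : a = sandwich s 1 e * sandwich 1 t e := by
    apply WithOne.coe_injective
    rw [h, WithOne.coe_mul, coe_sandwich, coe_sandwich, coe_sandwich, mul_one, one_mul]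
    conv_lhs => rw [← hee, WithOne.coe_mul]
    simp only [mul_assoc]
  refine ⟨_, ⟨⟨A.sandwich_mem _ _ he.1, fun hB => ha.2 ?_⟩, ?_⟩, _,
    ⟨⟨A.sandwich_mem _ _ he.1, fun hB => ha.2 ?_⟩, ?_⟩, h'⟩
  · rw [h']
    exact B.mul_right_mem _ _ hB
  · apply WithOne.coe_injective
    rw [WithOne.coe_mul, coe_sandwich, mul_one, mul_assoc, ← WithOne.coe_mul, hee]
  · rw [h']
    exact B.mul_left_mem _ _ hB
  · apply WithOne.coe_injective
    rw [WithOne.coe_mul, coe_sandwich, one_mul, ← mul_assoc, ← WithOne.coe_mul, hee]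

theorem mul_mem_LClass
    [Finite S] (hJ : IsJClass A B) (he : e ∈ A.carrier \ B.carrier) (hee : e * e = e) {q h : S} (hq : q ∈ LClass A B e) (hh : h ∈ LClass A B e)
    (hh' : h ∈ RClass A B e) : q * h ∈ LClass A B e :=
  ⟨mul_mem_of_mem_classes hJ he hee hq hh', by rw [mul_assoc, hh.2]⟩

theorem mul_mem_RClass
    [Finite S] (hJ : IsJClass A B) (he : e ∈ A.carrier \ B.carrier) (hee : e * e = e) {r h : S} (hr : r ∈ RClass A B e) (hh : h ∈ LClass A B e)
    (hh' : h ∈ RClass A B e) : h * r ∈ RClass A B e :=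
  ⟨mul_mem_of_mem_classes hJ he hee hh hr, by rw [← mul_assoc, hh'.2]⟩

theorem self_mem_HClass
    (he : e ∈ A.carrier \ B.carrier) (hee : e * e = e) : e ∈ LClass A B e ∧ e ∈ RClass A B e :=
  ⟨⟨he, hee⟩, he, hee⟩

theorem exists_left_inv
    [Finite S] (hJ : IsJClass A B) (he : e ∈ A.carrier \ B.carrier) (hee : e * e = e) (h : HClass A B e) : ∃ g : HClass A B e, g.1 * h.1 = e := by
  obtain ⟨u, hu⟩ := exists_mul_eq_of_mem_LClass hJ he h.memL
  have hu' : e * u * e * h.1 = e := by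
    rw [mul_assoc _ e, h.memR.2, mul_assoc, hu, hee]
  have hmem : e * u * e ∈ A.carrier \ B.carrier :=
    ⟨A.mul_left_mem _ _ he.1, fun hB => he.2 (by rw [← hu']; exact B.mul_right_mem _ _ hB)⟩
  exact ⟨⟨e * u * e, ⟨hmem, by rw [mul_assoc, hee]⟩, ⟨hmem, by simp only [← mul_assoc, hee]⟩⟩, hu'⟩

/-- The group structure of a maximal subgroup. -/
noncomputable abbrev HClass.group
    [Finite S] (hJ : IsJClass A B) (he : e ∈ A.carrier \ B.carrier) (hee : e * e = e) : Group (HClass A B e) :=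
  letI : Mul (HClass A B e) :=
    ⟨fun x y => ⟨x.1 * y.1, mul_mem_LClass hJ he hee x.memL y.memL y.memR,
      mul_mem_RClass hJ he hee y.memR x.memL x.memR⟩⟩
  letI : One (HClass A B e) := ⟨⟨e, (self_mem_HClass he hee).1, (self_mem_HClass he hee).2⟩⟩
  letI : Inv (HClass A B e) := ⟨fun h => (exists_left_inv hJ he hee h).choose⟩
  Group.ofLeftAxioms (fun _ _ _ => HClass.ext (mul_assoc _ _ _))
    (fun x => HClass.ext x.memR.2)
    (fun x => HClass.ext (exists_left_inv hJ he hee x).choose_spec)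

theorem exists_LClass_transversal
    [Finite S] (hJ : IsJClass A B) (he : e ∈ A.carrier \ B.carrier) (hee : e * e = e) :
    ∃ (n : ℕ) (q : Fin n → S), (∀ i, q i ∈ LClass A B e) ∧
      (∀ x ∈ LClass A B e, ∃ i, ∃ h : HClass A B e, x = q i * h.1) ∧
      ∀ i k, ∀ h : HClass A B e, q k = q i * h.1 → i = k := by
  let := HClass.group hJ he hee
  let r : Setoid (LClass A B e) :=
    { r := fun x y => ∃ h : HClass A B e, y.1 = x.1 * h.1
      iseqv :=
        { refl := fun x => ⟨1, x.2.2.symm⟩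
          symm := by
            rintro x y ⟨h, hh⟩
            refine ⟨h⁻¹, ?_⟩
            have h1 : h.1 * (h⁻¹).1 = e := congrArg HClass.val (mul_inv_cancel h)
            rw [hh, mul_assoc, h1, x.2.2]
          trans := by
            rintro x y z ⟨h, hh⟩ ⟨g, hg⟩
            exact ⟨h * g, by rw [hg, hh, mul_assoc]; rfl⟩ } }
  obtain ⟨n, q, hq, hq'⟩ := exists_transversal r
  exact ⟨n, fun i => (q i).1, fun i => (q i).2,
    fun x hx => hq ⟨x, hx⟩, fun i k h hh => hq' i k ⟨h, hh⟩⟩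

theorem exists_RClass_transversal
    [Finite S] (hJ : IsJClass A B) (he : e ∈ A.carrier \ B.carrier) (hee : e * e = e) :
    ∃ (m : ℕ) (q : Fin m → S), (∀ i, q i ∈ RClass A B e) ∧
      (∀ x ∈ RClass A B e, ∃ i, ∃ h : HClass A B e, x = h.1 * q i) ∧
      ∀ i k, ∀ h : HClass A B e, q k = h.1 * q i → i = k := by
  let := HClass.group hJ he hee
  let r : Setoid (RClass A B e) :=
    { r := fun x y => ∃ h : HClass A B e, y.1 = h.1 * x.1
      iseqv :=
        { refl := fun x => ⟨1, x.2.2.symm⟩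
          symm := by
            rintro x y ⟨h, hh⟩
            refine ⟨h⁻¹, ?_⟩
            have h1 : (h⁻¹).1 * h.1 = e := congrArg HClass.val (inv_mul_cancel h)
            rw [hh, ← mul_assoc, h1, x.2.2]
          trans := by
            rintro x y z ⟨h, hh⟩ ⟨g, hg⟩
            exact ⟨g * h, by rw [hg, hh, ← mul_assoc]; rfl⟩ } }
  obtain ⟨n, q, hq, hq'⟩ := exists_transversal r
  exact ⟨n, fun i => (q i).1, fun i => (q i).2,
    fun x hx => hq ⟨x, hx⟩, fun i k h hh => hq' i k ⟨h, hh⟩⟩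

theorem mul_mem_HClass
    {q r : S} (hr : r ∈ RClass A B e) (hq : q ∈ LClass A B e)
    (h : r * q ∉ B.carrier) : r * q ∈ LClass A B e ∧ r * q ∈ RClass A B e :=
  ⟨⟨⟨A.mul_left_mem _ _ hq.1.1, h⟩, by rw [mul_assoc, hq.2]⟩,
    ⟨A.mul_left_mem _ _ hq.1.1, h⟩, by rw [← mul_assoc, hr.2]⟩

/-- A finite principal factor with a nonzero idempotent is a regular Rees matrix semigroup. -/
theorem exists_reesIso
    [Finite S] (hJ : IsJClass A B) (he : e ∈ A.carrier \ B.carrier) (hee : e * e = e) (hBA : B.carrier ⊆ A.carrier) :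
    ∃ (H : Type u) (_ : Group H) (n m : ℕ) (Q : Matrix (Fin m) (Fin n) (WithZero H)),
      (∀ j, ∃ i, Q j i ≠ 0) ∧ (∀ i, ∃ j, Q j i ≠ 0) ∧ Nonempty (ReesIso A B Q) := by
  classical
  let := HClass.group hJ he hee
  have hmulval : ∀ g h : HClass A B e, (g * h).1 = g.1 * h.1 := fun _ _ => rfl
  -- Coordinates come from representatives of the orbits of the maximal subgroup at `e`: it acts on
  -- `LClass` from the right and on `RClass` from the left.
  obtain ⟨n, q, hqL, hq, hq_inj⟩ := exists_LClass_transversal hJ he hee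
  obtain ⟨m, r, hrR, hr, hr_inj⟩ := exists_RClass_transversal hJ he hee
  let Q : Matrix (Fin m) (Fin n) (WithZero (HClass A B e)) := fun j i =>
    if h : r j * q i ∉ B.carrier then
      ((⟨r j * q i, (mul_mem_HClass (hrR j) (hqL i) h).1,
        (mul_mem_HClass (hrR j) (hqL i) h).2⟩ : HClass A B e) :
        WithZero (HClass A B e))
    else 0
  have hQpos : ∀ j i (h : r j * q i ∉ B.carrier), Q j i =
      ((⟨r j * q i, (mul_mem_HClass (hrR j) (hqL i) h).1,
        (mul_mem_HClass (hrR j) (hqL i) h).2⟩ : HClass A B e) :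
        WithZero (HClass A B e)) := fun j i h => dif_pos h
  have hQneg : ∀ j i, r j * q i ∈ B.carrier → Q j i = 0 := fun j i h => dif_neg (not_not.2 h)
  have hQne : ∀ j i, r j * q i ∉ B.carrier → Q j i ≠ 0 := fun j i h => by
    rw [hQpos j i h]; exact WithZero.coe_ne_zero
  let ψ : HClass A B e → Fin n → Fin m → S := fun h i j => q i * h.1 * r j
  have hψmem : ∀ h i j, ψ h i j ∈ A.carrier \ B.carrier := fun h i j =>
    mul_mem_of_mem_classes hJ he hee (mul_mem_LClass hJ he hee (hqL i) h.memL h.memR) (hrR j)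
  have hψsurj : ∀ a ∈ A.carrier \ B.carrier, ∃ h i j, a = ψ h i j := by
    intro a ha
    obtain ⟨x, hx, y, hy, rfl⟩ := exists_eq_mul_of_mem hJ he hee ha
    obtain ⟨i, h, rfl⟩ := hq x hx
    obtain ⟨j, g, rfl⟩ := hr y hy
    exact ⟨h * g, i, j, by simp only [ψ, hmulval, mul_assoc]⟩
  have hψinj : ∀ h i j g k l, ψ h i j = ψ g k l → h = g ∧ i = k ∧ j = l := by
    intro h i j g k l hyp
    simp only [ψ] at hyp
    have hinv : ∀ x : HClass A B e, x.1 * (x⁻¹).1 = e := fun x =>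
      congrArg HClass.val (mul_inv_cancel x)
    have hinv' : ∀ x : HClass A B e, (x⁻¹).1 * x.1 = e := fun x =>
      congrArg HClass.val (inv_mul_cancel x)
    -- Cancelling `r j` on the right expresses `q i * h` as `q k` times an element of the maximal
    -- subgroup, so `q i` and `q k` lie in one orbit.
    have hik : k = i := by
      obtain ⟨v, hv⟩ := exists_mul_eq_of_mem_RClass hJ he (hrR j)
      have h1 : q i * h.1 = q k * (g.1 * (r l * v * e)) := by
        calc q i * h.1 = q i * h.1 * r j * v * e := by
              rw [mul_assoc _ (r j), hv, mul_assoc _ e, hee, mul_assoc, h.memL.2]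
          _ = _ := by rw [hyp]; simp only [mul_assoc]
      have hmem : g.1 * (r l * v * e) ∈ A.carrier \ B.carrier := by
        refine ⟨A.mul_right_mem _ _ g.memL.1.1, fun hB => ?_⟩
        refine (mul_mem_LClass hJ he hee (hqL i) h.memL h.memR).1.2 ?_
        rw [h1]
        exact B.mul_left_mem _ _ hB
      have hL : g.1 * (r l * v * e) * e = g.1 * (r l * v * e) := by simp only [mul_assoc, hee]
      have hR : e * (g.1 * (r l * v * e)) = g.1 * (r l * v * e) := by rw [← mul_assoc, g.memR.2]
      refine hq_inj k i (⟨g.1 * (r l * v * e), ⟨hmem, hL⟩, ⟨hmem, hR⟩⟩ * h⁻¹) ?_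
      rw [hmulval, ← mul_assoc, ← h1, mul_assoc, hinv, (hqL i).2]
    have hjl : l = j := by
      obtain ⟨v, hv⟩ := exists_mul_eq_of_mem_LClass hJ he (hqL i)
      have h1 : h.1 * r j = (e * v * q k * g.1) * r l := by
        calc h.1 * r j = e * (v * q i) * h.1 * r j := by
              rw [hv, hee, h.memR.2]
          _ = e * v * (q i * h.1 * r j) := by simp only [mul_assoc]
          _ = _ := by rw [hyp]; simp only [mul_assoc]
      have hmem : e * v * q k * g.1 ∈ A.carrier \ B.carrier := by
        refine ⟨A.mul_left_mem _ _ g.memL.1.1, fun hB => ?_⟩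
        refine (mul_mem_RClass hJ he hee (hrR j) h.memL h.memR).1.2 ?_
        rw [h1]
        exact B.mul_right_mem _ _ hB
      have hL : e * v * q k * g.1 * e = e * v * q k * g.1 := by rw [mul_assoc, g.memL.2]
      have hR : e * (e * v * q k * g.1) = e * v * q k * g.1 := by simp only [← mul_assoc, hee]
      refine hr_inj l j (h⁻¹ * ⟨e * v * q k * g.1, ⟨hmem, hL⟩, ⟨hmem, hR⟩⟩) ?_
      rw [hmulval, mul_assoc, ← h1, ← mul_assoc, hinv', (hrR j).2]
    subst hik hjl
    refine ⟨HClass.ext ?_, rfl, rfl⟩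
    obtain ⟨v, hv⟩ := exists_mul_eq_of_mem_LClass hJ he (hqL k)
    obtain ⟨w, hw⟩ := exists_mul_eq_of_mem_RClass hJ he (hrR l)
    have key : ∀ x : HClass A B e, v * (q k * x.1 * r l) * w = x.1 := fun x => by
      calc v * (q k * x.1 * r l) * w = (v * q k) * x.1 * (r l * w) := by simp only [mul_assoc]
        _ = x.1 := by rw [hv, hw, x.memR.2, x.memL.2]
    rw [← key h, hyp, key g]
  have hψmul : ∀ h i j g k l, Q j k = 0 ∧ ψ h i j * ψ g k l ∈ B.carrier ∨
      ∃ p : HClass A B e, Q j k = (p : WithZero (HClass A B e)) ∧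
        ψ h i j * ψ g k l = ψ (h * p * g) i l := by
    intro h i j g k l
    have hprod : ψ h i j * ψ g k l = q i * h.1 * (r j * q k) * (g.1 * r l) := by
      simp only [ψ, mul_assoc]
    by_cases hB : r j * q k ∈ B.carrier
    · refine Or.inl ⟨hQneg _ _ hB, ?_⟩
      rw [hprod]
      exact B.mul_right_mem _ _ (B.mul_left_mem _ _ hB)
    · refine Or.inr ⟨_, hQpos _ _ hB, ?_⟩
      rw [hprod]
      simp only [ψ, hmulval, mul_assoc]
  -- The choice of a triple is harmless, since `ψ` is injective and its values lie outside `B`.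
  let f : factor A B → Rees Q := fun c =>
    if h : ∃ t : HClass A B e × Fin n × Fin m, c.1 = B.proj (ψ t.1 t.2.1 t.2.2) then
      Rees.elt h.choose.1 h.choose.2.1 h.choose.2.2
    else Rees.theta
  have hproj : ∀ x h i j, B.proj x = B.proj (ψ h i j) → x = ψ h i j := by
    intro x h i j hx
    rcases (Con.eq _).1 hx with hx | hx
    · exact hx
    · exact absurd hx.2 (hψmem h i j).2
  have hf_elt : ∀ (c : factor A B) h i j, c.1 = B.proj (ψ h i j) → f c = Rees.elt h i j := by
    intro c h i j hc
    have hex : ∃ t : HClass A B e × Fin n × Fin m, c.1 = B.proj (ψ t.1 t.2.1 t.2.2) :=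
      ⟨(h, i, j), hc⟩
    obtain ⟨h1, h2, h3⟩ := hψinj _ _ _ _ _ _ (hproj _ _ _ _ (hex.choose_spec.symm.trans hc))
    simp only [f, dif_pos hex, h1, h2, h3]
  have hf_theta : ∀ (c : factor A B) b, b ∈ B.carrier → c.1 = B.proj b → f c = Rees.theta := by
    intro c b hb hc
    refine dif_neg ?_
    rintro ⟨t, ht⟩
    refine (hψmem t.1 t.2.1 t.2.2).2 ?_
    rw [← hproj _ _ _ _ (hc.symm.trans ht)]
    exact hb
  have hcases : ∀ c : factor A B, (∃ b ∈ B.carrier, c.1 = B.proj b) ∨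
      ∃ h i j, c.1 = B.proj (ψ h i j) := by
    rintro ⟨_, x, hx, rfl⟩
    by_cases hB : x ∈ B.carrier
    · exact Or.inl ⟨x, hB, rfl⟩
    · obtain ⟨h, i, j, rfl⟩ := hψsurj x ⟨hx, hB⟩
      exact Or.inr ⟨h, i, j, rfl⟩
  have hf_mul : ∀ c d, f (c * d) = f c * f d := by
    intro c d
    rcases hcases c with ⟨b, hb, hc⟩ | ⟨h, i, j, hc⟩
    · rw [hf_theta c b hb hc, Rees.theta_mul]
      obtain ⟨_, y, hy, rfl⟩ := d
      refine hf_theta _ (b * y) (B.mul_right_mem _ _ hb) ?_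
      rw [map_mul, ← hc]
      rfl
    · rcases hcases d with ⟨b, hb, hd⟩ | ⟨g, k, l, hd⟩
      · rw [hf_theta d b hb hd, Rees.mul_theta]
        refine hf_theta _ (ψ h i j * b) (B.mul_left_mem _ _ hb) ?_
        rw [map_mul, ← hc, ← hd]
        rfl
      · have hcd : (c * d).1 = B.proj (ψ h i j * ψ g k l) := by
          rw [map_mul, ← hc, ← hd]
          rfl
        rw [hf_elt c h i j hc, hf_elt d g k l hd, Rees.elt_mul_elt]
        rcases hψmul h i j g k l with ⟨hQ, hB⟩ | ⟨p, hQ, hp⟩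
        · rw [hf_theta _ _ hB hcd, hQ, mul_zero, zero_mul]
          rfl
        · rw [hf_elt (c * d) (h * p * g) i l (by rw [hcd, hp]), hQ]
          rfl
  refine ⟨HClass A B e, inferInstance, n, m, Q, fun j => ?_, fun i => ?_,
    ⟨⟨⟨f, hf_mul⟩, ?_, ?_⟩⟩⟩
  · obtain ⟨v, hv⟩ := exists_mul_eq_of_mem_RClass hJ he (hrR j)
    have hrv : r j * (v * e) = e := by rw [← mul_assoc, hv, hee]
    have hmem : v * e ∈ LClass A B e :=
      ⟨⟨A.mul_left_mem _ _ he.1, fun hB => he.2 (by rw [← hrv]; exact B.mul_left_mem _ _ hB)⟩,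
        by rw [mul_assoc, hee]⟩
    obtain ⟨i, h, hi⟩ := hq _ hmem
    refine ⟨i, hQne j i fun hB => he.2 ?_⟩
    rw [← hrv, hi, ← mul_assoc]
    exact B.mul_right_mem _ _ hB
  · obtain ⟨v, hv⟩ := exists_mul_eq_of_mem_LClass hJ he (hqL i)
    have hrv : e * v * q i = e := by rw [mul_assoc, hv, hee]
    have hmem : e * v ∈ RClass A B e :=
      ⟨⟨A.mul_right_mem _ _ he.1, fun hB => he.2 (by rw [← hrv]; exact B.mul_right_mem _ _ hB)⟩,
        by rw [← mul_assoc, hee]⟩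
    obtain ⟨j, h, hj⟩ := hr _ hmem
    refine ⟨j, hQne j i fun hB => he.2 ?_⟩
    rw [← hrv, hj, mul_assoc]
    exact B.mul_left_mem _ _ hB
  · intro c d hcd
    change f c = f d at hcd
    rcases hcases c with ⟨b, hb, hc⟩ | ⟨h, i, j, hc⟩ <;>
      rcases hcases d with ⟨b', hb', hd⟩ | ⟨g, k, l, hd⟩
    · exact Subtype.ext (hc.trans (((Con.eq _).2 (Or.inr ⟨hb, hb'⟩)).trans hd.symm))
    · rw [hf_theta c b hb hc, hf_elt d g k l hd] at hcd
      cases hcd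
    · rw [hf_theta d b' hb' hd, hf_elt c h i j hc] at hcd
      cases hcd
    · rw [hf_elt c h i j hc, hf_elt d g k l hd] at hcd
      cases hcd
      exact Subtype.ext (hc.trans hd.symm)
  · rintro (_ | ⟨h, i, j⟩)
    · refine ⟨fun hc _ => ?_, fun hB => ?_⟩
      · obtain ⟨c, hc⟩ := hc
        change f c = _ at hc
        rcases hcases c with ⟨b, hb, _⟩ | ⟨h, i, j, hc'⟩
        · exact ⟨b, hb⟩
        · rw [hf_elt c h i j hc'] at hc
          cases hc
      · obtain ⟨b, hb⟩ := hB rfl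
        exact ⟨factor.mk B b (hBA hb), hf_theta _ b hb rfl⟩
    · refine ⟨fun _ h => (by cases h), fun _ => ?_⟩
      exact ⟨factor.mk B (ψ h i j) (hψmem h i j).1, hf_elt _ h i j rfl⟩

end ReesTheorem

section Root

variable {S : Type u} [Semigroup S]

/-! ### `𝓙`-classes that are minimal modulo `η*` -/

/-- `𝓡`-comparable elements of a Rees matrix factor `A / B`, modulo `η*`, have row indices in the
same class, if no element of `A ∖ B` is related to one of `B`. -/
theorem ReesIso.IsAt.cls_eq {A B : SgIdeal S} {G : Type v} [Group G] {n m : ℕ}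
    {P : Matrix (Fin m) (Fin n) (WithZero G)} (hP : IsCSDiagonal P) {E : ReesIso A B P}
    (hN : ∀ z ∈ A.carrier \ B.carrier, ∀ z' ∈ B.carrier, ¬ etaStar S z z')
    {y y' c : S} {i i' : Fin n} {j j' : Fin m} (hy : E.IsAt y i j) (hy' : E.IsAt y' i' j')
    (h : etaStar S y (y' * c)) : hP.cls i = hP.cls i' := by
  obtain ⟨l, hl⟩ := hP.col i
  obtain ⟨w, hw⟩ := E.exists_isAt_coords i l
  refine Quotient.sound ⟨l, hl, (hw.mul_notMem_iff hy').1 fun hB => ?_⟩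
  refine hN (w * y) (hw.mul hy hl).mem (w * y' * c) (B.mul_right_mem _ _ hB) ?_
  rw [mul_assoc]
  exact (etaStar S).mul ((etaStar S).refl w) h

theorem ReesIso.exists_etaStar_mul [Finite S] {A B : SgIdeal S} (hJ : IsJClass A B) {G : Type v}
    [Group G] {n m : ℕ} {P : Matrix (Fin m) (Fin n) (WithZero G)} (E : ReesIso A B P)
    {x x' : S} {a a' : Fin n} {j j' r : Fin m}
    (hx : E.IsAt x a j) (hx' : E.IsAt x' a' j') (hr : P r a ≠ 0) (hr' : P r a' ≠ 0) :
    ∃ c, etaStar S x (x' * c) := by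
  obtain ⟨w, hw⟩ := E.exists_isAt_coords a r
  exact hJ.exists_etaStar_mul hw.mem hx.mem (hw.mul hx hr).mem.2 (hw.mul hx' hr').mem.2

/-- A Rees matrix factor `A / B` is `CS`-diagonal if no element of `A ∖ B` is `η*`-related to one
of `B`. -/
theorem ReesIso.isCSDiagonal [Finite S] {A B : SgIdeal S} (hJ : IsJClass A B) {G : Type v}
    [Group G] {n m : ℕ} {P : Matrix (Fin m) (Fin n) (WithZero G)} (E : ReesIso A B P)
    (hrow : ∀ j, ∃ i, P j i ≠ 0) (hcol : ∀ i, ∃ j, P j i ≠ 0)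
    (hN : ∀ z ∈ A.carrier \ B.carrier, ∀ z' ∈ B.carrier, ¬ etaStar S z z') :
    IsCSDiagonal P where
  row := hrow
  col := hcol
  diag r r' t t' h₁ h₂ h₃ := by
    obtain ⟨x, hx⟩ := E.exists_isAt_coords t r
    obtain ⟨x', hx'⟩ := E.exists_isAt_coords t' r
    obtain ⟨w, hw⟩ := E.exists_isAt_coords t r'
    -- The shared row `r` puts `x` in `x' S` modulo `η*`. So if `w x'` fell into `B`, the element `w
    -- x` outside `B` would be related to one of `B`.
    obtain ⟨c, hc⟩ := E.exists_etaStar_mul hJ hx hx' h₁ h₃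
    refine (hw.mul_notMem_iff hx').1 fun hB => ?_
    refine hN (w * x) (hw.mul hx h₂).mem (w * x' * c) (B.mul_right_mem _ _ hB) ?_
    rw [mul_assoc]
    exact (etaStar S).mul ((etaStar S).refl w) hc

theorem ReesIso.exists_idempotent {A B : SgIdeal S} {G : Type v} [Group G] {n m : ℕ}
    {P : Matrix (Fin m) (Fin n) (WithZero G)} (E : ReesIso A B P) {i : Fin n} {j : Fin m}
    (h : P j i ≠ 0) : ∃ f ∈ A.carrier \ B.carrier, f * f = f := by
  obtain ⟨p, hp⟩ := WithZero.ne_zero_iff_exists.1 h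
  obtain ⟨f, hf⟩ := E.exists_isElt p⁻¹ i j
  have hA : f * f ∈ A.carrier := A.mul_left_mem _ _ hf.mem.1
  have hmul := hf.hom_mul hf hA
  rw [← hp, ← WithZero.coe_mul, ← WithZero.coe_mul, inv_mul_cancel, one_mul] at hmul
  have heq := congrArg Subtype.val (E.injective (hmul.trans hf.choose_spec.symm))
  refine ⟨f, hf.mem, ((Con.eq _).1 heq).resolve_right fun hB => hf.mem.2 hB.2⟩

/-- All powers of `y` are related to `f = f f`, and one of them is idempotent. -/
theorem exists_idempotent_etaStar [Finite S] {A : SgIdeal S} {f y : S} (hf : f * f = f)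
    (hy : y ∈ A.carrier) (hfy : etaStar S f y) :
    ∃ e ∈ A.carrier, e * e = e ∧ etaStar S f e := by
  have hpow : ∀ n : ℕ, ∃ d ∈ A.carrier, (d : WithOne S) = (y : WithOne S) ^ (n + 1) ∧
      etaStar S f d := by
    intro n
    induction n with
    | zero => exact ⟨y, hy, by rw [zero_add, pow_one], hfy⟩
    | succ n ih =>
      obtain ⟨d, hdA, hd, hfd⟩ := ih
      refine ⟨d * y, A.mul_left_mem _ _ hy, by rw [WithOne.coe_mul, hd, pow_succ _ (n + 1)], ?_⟩
      rw [← hf]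
      exact (etaStar S).mul hfd hfy
  obtain ⟨n, hn⟩ := exists_pow_idempotent (y : WithOne S)
  obtain ⟨d, hdA, hd, hfd⟩ := hpow n
  refine ⟨d, hdA, WithOne.coe_injective ?_, hfd⟩
  rw [WithOne.coe_mul, hd, hn]

/-- The last factor of a principal series that meets the image of `S_p ∖ S_{p+1}` in `S / η*`. -/
theorem PrincipalSeries.exists_last (σ : PrincipalSeries S) {p : ℕ} (hp : 1 ≤ p)
    (hpo : p ≤ σ.o) :
    ∃ q, p ≤ q ∧ q ≤ σ.o ∧ (∀ x ∈ σ.layer p, ∃ y ∈ σ.layer q, etaStar S x y) ∧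
      ∀ z ∈ σ.layer p ∪ σ.layer q, ∀ z' ∈ (σ.ideal (q + 1)).carrier, ¬ etaStar S z z' := by
  classical
  let M : ℕ → Prop := fun q => ∃ x ∈ σ.layer p, ∃ y ∈ (σ.ideal q).carrier, etaStar S x y
  have hMp : M p := by
    obtain ⟨x, hx, hx'⟩ := Set.exists_of_ssubset (σ.strict p hp hpo)
    exact ⟨x, ⟨hx, hx'⟩, x, hx, (etaStar S).refl x⟩
  let q := Nat.findGreatest M σ.o
  have hpq : p ≤ q := Nat.le_findGreatest hpo hMp
  have hqo : q ≤ σ.o := Nat.findGreatest_le σ.o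
  obtain ⟨x, hx, y, hy, hxy⟩ : M q := Nat.findGreatest_spec hpo hMp
  have hN : ∀ z ∈ σ.layer p, ∀ z' ∈ (σ.ideal (q + 1)).carrier, ¬ etaStar S z z' := by
    intro z hz z' hz' h
    rcases hqo.lt_or_eq with hlt | heq
    · exact Nat.findGreatest_is_greatest (Nat.lt_succ_self q) hlt ⟨z, hz, z', hz', h⟩
    · rw [heq, σ.last] at hz'
      exact hz'
  have hyq : y ∈ σ.layer q := ⟨hy, fun h => hN x hx y h hxy⟩
  refine ⟨q, hpq, hqo, fun a ha => ?_, ?_⟩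
  · obtain ⟨s, t, rfl⟩ := σ.isJClass hp hpo x a hx ha
    have h := etaStar_sandwich s t hxy
    exact ⟨sandwich s t y, ⟨SgIdeal.sandwich_mem _ _ _ hy, fun h' => hN _ ha _ h' h⟩, h⟩
  · rintro z (hz | hz) z' hz' h
    · exact hN z hz z' hz' h
    -- Writing `y` as `s z t` turns a relation between `z` and `z'` into one between `x` and `s z'
    -- t`, which lies in `S_{q+1}`.
    · obtain ⟨s, t, hst⟩ := σ.isJClass (hp.trans hpq) hqo z y hz hyq
      refine hN x hx (sandwich s t z') (SgIdeal.sandwich_mem _ _ _ hz') ?_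
      exact (etaStar S).trans hxy (hst ▸ etaStar_sandwich s t h)

end Root

/-! ### The minimal non-nilpotent representation -/

section Gamma

variable {S : Type u} [Semigroup S] {A B : SgIdeal S} {G : Type v} [Group G] {n m : ℕ}
  {P : Matrix (Fin m) (Fin n) (WithZero G)} {hP : IsCSDiagonal P} {E : ReesIso A B P}

theorem gammaRel_of_gamma_eq_some {s : B.ReesQuotient} {k k' : hP.Class}
    (h : Gamma hP E s (some k) = some k') : GammaRel hP E s k k' := by
  by_cases hex : ∃ k', GammaRel hP E s k k'
  · have h' : some hex.choose = some k' := by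
      rw [← h, Gamma, dif_pos hex]
    rw [← Option.some_injective _ h']
    exact hex.choose_spec
  · have h' : none = some k' := by
      rw [← h, Gamma, dif_neg hex]
    cases h'

theorem GammaRel.exists_isAt {v : S} {k k' : hP.Class} (h : GammaRel hP E (B.proj v) k k') :
    ∃ b i i' j, E.IsAt b i j ∧ E.IsAt (v * b) i' j ∧ hP.cls i = k ∧ hP.cls i' = k' := by
  obtain ⟨⟨_, b, hb, rfl⟩, y, g, g', i, i', j, hx, hy, hi, hi', heq⟩ := h
  have hA : v * b ∈ A.carrier := A.mul_left_mem _ _ hb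
  have hvb : factor.mk B (v * b) hA = y := Subtype.ext heq
  exact ⟨b, i, i', j, ⟨g, hb, hx⟩, ⟨g', hA, hvb ▸ hy⟩, hi, hi'⟩

/-- `Γ(v)(k) = k'` determines the class of the row index of `v b`. -/
theorem GammaRel.mul_isAt {v : S} {k k' : hP.Class} (h : GammaRel hP E (B.proj v) k k')
    {b : S} {i : Fin n} {j : Fin m} (hb : E.IsAt b i j) (hi : hP.cls i = k) :
    ∃ i' j', E.IsAt (v * b) i' j' ∧ hP.cls i' = k' := by
  obtain ⟨b₀, i₀, i₁, j₀, hb₀, hvb₀, hi₀, rfl⟩ := h.exists_isAt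
  obtain ⟨l, hl⟩ := hP.col i₁
  obtain ⟨w, hw⟩ := E.exists_isAt_coords i₁ l
  have hwvb₀ : w * v * b₀ ∉ B.carrier := by
    rw [mul_assoc]
    exact (hw.mul hvb₀ hl).mem.2
  -- The product `w v` is itself an element of the layer. Its row is nonzero at `i₀`, hence on the
  -- whole class `k`, so it also detects `b`.
  obtain ⟨i₂, j₂, hwv⟩ := E.exists_isAt (x := w * v)
    ⟨A.mul_right_mem _ _ hw.mem.1, fun h => hwvb₀ (B.mul_right_mem _ _ h)⟩
  have h₂ : P j₂ i ≠ 0 := by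
    rw [← hP.rowMem_iff, hi, ← hi₀, hP.rowMem_iff]
    exact (hwv.mul_notMem_iff hb₀).1 hwvb₀
  have hwvb : w * (v * b) ∉ B.carrier := by
    rw [← mul_assoc]
    exact (hwv.mul hb h₂).mem.2
  obtain ⟨i', j', hvb⟩ := E.exists_isAt (x := v * b)
    ⟨A.mul_left_mem _ _ hb.mem.1, fun h => hwvb (B.mul_left_mem _ _ h)⟩
  exact ⟨i', j', hvb, Quotient.sound ⟨l, (hw.mul_notMem_iff hvb).1 hwvb, hl⟩⟩

/-- Right multiplication by a suitable `c` tests the last index: `b c` still has first index `i`, so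
`v b c` stays outside `B`. -/
theorem GammaRel.mul_isAt_rowMem {v : S} {k k' l : hP.Class}
    (h : GammaRel hP E (B.proj v) k k') {b : S} {i : Fin n} {j : Fin m} (hb : E.IsAt b i j)
    (hi : hP.cls i = k) (hj : hP.RowMem j l) :
    ∃ i' j', E.IsAt (v * b) i' j' ∧ hP.cls i' = k' ∧ hP.RowMem j' l := by
  obtain ⟨i', j', hvb, hi'⟩ := h.mul_isAt hb hi
  obtain ⟨t, rfl, ht⟩ := hj
  obtain ⟨c, hc⟩ := E.exists_isAt_coords t j
  refine ⟨i', j', hvb, hi', t, rfl, (hvb.mul_notMem_iff hc).1 ?_⟩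
  obtain ⟨_, _, hvbc, _⟩ := h.mul_isAt (hb.mul hc ht) hi
  rw [mul_assoc]
  exact hvbc.mem.2

/-- One step of a Malcev sequence: the product keeps the first index of `x` and takes the class of
its last index from `y`. -/
theorem GammaRel.mul_mul_isAt {v x y : S} {k k' l : hP.Class}
    (h : GammaRel hP E (B.proj v) k k') {i i' : Fin n} {j j' : Fin m} (hx : E.IsAt x i j)
    (hj : hP.RowMem j k') (hy : E.IsAt y i' j') (hi' : hP.cls i' = k) (hj' : hP.RowMem j' l) :
    ∃ j'', E.IsAt (x * v * y) i j'' ∧ hP.RowMem j'' l := by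
  obtain ⟨t, r, hvy, rfl, hr⟩ := h.mul_isAt_rowMem hy hi' hj'
  refine ⟨r, ?_, hr⟩
  rw [mul_assoc]
  exact hx.mul hvy ((hP.rowMem_iff j t).1 hj)

/-- Two elements that are interchanged by the minimal non-nilpotent representation yield Malcev
sequences which stay in two fixed rows, and these rows are connected by `η*`. -/
theorem exists_etaStar_of_gammaRel [Finite S] {k₁ k₂ k₃ k₄ : hP.Class} {v₁ v₂ : S}
    (h₁₂ : GammaRel hP E (B.proj v₁) k₁ k₂) (h₃₄ : GammaRel hP E (B.proj v₁) k₃ k₄)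
    (h₁₄ : GammaRel hP E (B.proj v₂) k₁ k₄) (h₃₂ : GammaRel hP E (B.proj v₂) k₃ k₂) :
    ∃ x y i i' j j', E.IsAt x i j ∧ E.IsAt y i' j' ∧ hP.cls i = k₁ ∧ hP.cls i' = k₃ ∧
      etaStar S x y := by
  classical
  obtain ⟨i₁, rfl⟩ := Quotient.exists_rep k₁
  obtain ⟨i₂, rfl⟩ := Quotient.exists_rep k₂
  obtain ⟨i₃, rfl⟩ := Quotient.exists_rep k₃
  obtain ⟨i₄, rfl⟩ := Quotient.exists_rep k₄
  obtain ⟨j₂, hj₂⟩ := hP.col i₂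
  obtain ⟨j₄, hj₄⟩ := hP.col i₄
  obtain ⟨x, hx⟩ := E.exists_isAt_coords i₁ j₂
  obtain ⟨y, hy⟩ := E.exists_isAt_coords i₃ j₄
  -- The first inserted element is `z 1 = v₂`. Each step exchanges the last-index classes of the two
  -- entries between `k₂` and `k₄`, so the next inserted element must be the other `v`.
  let z : ℕ → S := fun n => if Even n then v₁ else v₂
  have key : ∀ n, ∃ j j', E.IsAt (malcev x y z n).1 i₁ j ∧ E.IsAt (malcev x y z n).2 i₃ j' ∧
      (Even n → hP.RowMem j (hP.cls i₂) ∧ hP.RowMem j' (hP.cls i₄)) ∧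
      (¬ Even n → hP.RowMem j (hP.cls i₄) ∧ hP.RowMem j' (hP.cls i₂)) := by
    intro n
    induction n with
    | zero =>
      exact ⟨j₂, j₄, hx, hy, fun _ => ⟨⟨i₂, rfl, hj₂⟩, i₄, rfl, hj₄⟩,
        fun h => absurd Even.zero h⟩
    | succ n ih =>
      obtain ⟨j, j', hl, hr, heven, hodd⟩ := ih
      by_cases hn : Even n
      · obtain ⟨hj, hj'⟩ := heven hn
        have hn' : ¬ Even (n + 1) := by rwa [Nat.even_add_one, not_not]
        have hz : z (n + 1) = v₂ := if_neg hn'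
        obtain ⟨a, ha, ha'⟩ := h₃₂.mul_mul_isAt hl hj hr rfl hj'
        obtain ⟨b, hb, hb'⟩ := h₁₄.mul_mul_isAt hr hj' hl rfl hj
        refine ⟨a, b, ?_, ?_, fun h => absurd h hn', fun _ => ⟨ha', hb'⟩⟩
        · simpa only [malcev, hz] using ha
        · simpa only [malcev, hz] using hb
      · obtain ⟨hj, hj'⟩ := hodd hn
        have hn' : Even (n + 1) := by rwa [Nat.even_add_one]
        have hz : z (n + 1) = v₁ := if_pos hn'
        obtain ⟨a, ha, ha'⟩ := h₃₄.mul_mul_isAt hl hj hr rfl hj'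
        obtain ⟨b, hb, hb'⟩ := h₁₂.mul_mul_isAt hr hj' hl rfl hj
        refine ⟨a, b, ?_, ?_, fun _ => ⟨ha', hb'⟩, fun h => absurd hn' h⟩
        · simpa only [malcev, hz] using ha
        · simpa only [malcev, hz] using hb
  obtain ⟨n, hn⟩ := exists_etaStar_malcev x y z
  obtain ⟨j, j', hl, hr, -⟩ := key n
  exact ⟨_, _, i₁, i₃, j, j', hl, hr, rfl, rfl, hn⟩

end Gamma

/-! ### The function `φ` and the root -/

/-- The function `φ_{η*}`: `𝓡`-classes of `A ∖ B` are mapped to classes of row indices of a factor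
`A' / B'` to which `A ∖ B` is related, and `𝓡`-comparability modulo `η*` forces equal values. -/
theorem exists_isPhi {S : Type u} [Semigroup S] [Finite S] {A B A' B' : SgIdeal S}
    (hJ : IsJClass A B) {G : Type v} [Group G] {n m : ℕ}
    {P : Matrix (Fin m) (Fin n) (WithZero G)} (hP : IsCSDiagonal P) (E : ReesIso A B P)
    (hrel : ∀ x ∈ A.carrier \ B.carrier, ∃ y ∈ A'.carrier \ B'.carrier, etaStar S x y)
    (hN : ∀ z ∈ A'.carrier \ B'.carrier, ∀ z' ∈ B'.carrier, ¬ etaStar S z z')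
    {H : Type w} [Group H] {n' m' : ℕ} {Q : Matrix (Fin m') (Fin n') (WithZero H)}
    (hQ : IsCSDiagonal Q) (F : ReesIso A' B' Q) :
    ∃ φ : Fin n → hQ.Class, IsPhi E hQ F φ ∧
      ∀ {x x' : S} {i i' : Fin n} {j j' : Fin m}, E.IsAt x i j → E.IsAt x' i' j' →
        etaStar S x x' → ∀ a a', hP.cls a = hP.cls i → hP.cls a' = hP.cls i' → φ a = φ a' := by
  have hcls : ∀ {a a' : Fin n} {x x' : S} {j j' : Fin m}, E.IsAt x a j → E.IsAt x' a' j' →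
      hP.cls a = hP.cls a' → ∃ c, etaStar S x (x' * c) := by
    intro a a' x x' j j' hx hx' h
    obtain ⟨r, hr, hr'⟩ : ∃ r, P r a ≠ 0 ∧ P r a' ≠ 0 := Quotient.exact h
    exact E.exists_etaStar_mul hJ hx hx' hr hr'
  have hlift : ∀ {x x' c y y' : S} {i i' : Fin n'} {j j' : Fin m'}, etaStar S x (x' * c) →
      etaStar S x y → etaStar S x' y' → F.IsAt y i j → F.IsAt y' i' j' →
      hQ.cls i = hQ.cls i' := by
    intro x x' c y y' i i' j j' h hy hy' hF hF'
    exact hF.cls_eq hQ hN hF' ((etaStar S).trans ((etaStar S).symm hy)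
      ((etaStar S).trans h ((etaStar S).mul hy' ((etaStar S).refl c))))
  have hex : ∀ a : Fin n, ∃ (x y : S) (r : Fin m) (i : Fin n') (j : Fin m'),
      E.IsAt x a r ∧ F.IsAt y i j ∧ etaStar S x y := by
    intro a
    obtain ⟨r, -⟩ := hP.col a
    obtain ⟨x, hx⟩ := E.exists_isAt_coords a r
    obtain ⟨y, hy, hxy⟩ := hrel x hx.mem
    obtain ⟨i, j, hF⟩ := F.exists_isAt hy
    exact ⟨x, y, r, i, j, hx, hF, hxy⟩
  choose x y r i j hE hF hxy using hex
  refine ⟨fun a => hQ.cls (i a), fun a k => ⟨?_, ?_⟩, ?_⟩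
  · rintro rfl
    obtain ⟨g, hg⟩ := hE a
    obtain ⟨h, hh⟩ := hF a
    exact ⟨x a, y a, g, r a, h, i a, j a, hg, hh, hxy a, rfl⟩
  · rintro ⟨x', y', g, r', h, i', j', hx', hy', hxy', rfl⟩
    obtain ⟨c, hc⟩ := hcls (hE a) ⟨g, hx'⟩ rfl
    exact hlift hc (hxy a) hxy' (hF a) ⟨h, hy'⟩
  · intro s s' b b' l l' hs hs' hss a a' ha ha'
    -- Chaining `x a` to `s c`, `s` to `s'`, and `s'` to `x a' * d` places `x a` in `x a' S` modulo
    -- `η*`.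
    obtain ⟨c, hc⟩ := hcls (hE a) hs ha
    obtain ⟨d, hd⟩ := hcls hs' (hE a') ha'.symm
    refine hlift (c := d * c) ?_ (hxy a) (hxy a') (hF a) (hF a')
    rw [← mul_assoc]
    exact (etaStar S).trans hc
      ((etaStar S).mul ((etaStar S).trans hss hd) ((etaStar S).refl c))

/-- The last factor of a principal series that meets the image of a Rees matrix factor in `S / η*`
is its `η*`-root. -/
theorem isEtaRoot_of_related {S : Type u} [Semigroup S] [Finite S] (σ : PrincipalSeries S)
    {p q : ℕ} (hp : 1 ≤ p) (hpq : p ≤ q) (hqo : q ≤ σ.o) {G : Type v} [Group G] {n m : ℕ}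
    {P : Matrix (Fin m) (Fin n) (WithZero G)} (hP : IsCSDiagonal P)
    (E : ReesIso (σ.ideal p) (σ.ideal (p + 1)) P) (hθ : ¬ ThetaIsRoot σ p)
    (hrel : ∀ x ∈ σ.layer p, ∃ y ∈ σ.layer q, etaStar S x y)
    (hN : ∀ z ∈ σ.layer p ∪ σ.layer q, ∀ z' ∈ (σ.ideal (q + 1)).carrier, ¬ etaStar S z z') :
    IsEtaRoot σ E q where
  not_theta := by
    obtain ⟨x, hx, hx'⟩ := Set.exists_of_ssubset (σ.strict p hp (hpq.trans hqo))
    exact ⟨x, ⟨hx, hx'⟩, fun θ h h' => hθ ⟨θ, h, x, ⟨hx, hx'⟩, h'⟩⟩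
  le := hpq
  le_o := hqo
  related := hrel
  not_related := hN
  csDiagonal := by
    obtain ⟨x, hx⟩ := Set.exists_of_ssubset (σ.strict p hp (hpq.trans hqo))
    obtain ⟨i, -⟩ := E.exists_isAt hx
    obtain ⟨j, hj⟩ := hP.col i
    -- The idempotent carried into layer `q` excludes a null factor and starts the Rees construction
    -- there.
    obtain ⟨f, hf, hff⟩ := E.exists_idempotent hj
    obtain ⟨y, hy, hfy⟩ := hrel f hf
    obtain ⟨e, he, hee, hfe⟩ := exists_idempotent_etaStar hff hy.1 hfy
    have hJ := σ.isJClass (hp.trans hpq) hqo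
    obtain ⟨H, hH, n', m', Q, hrow, hcol, ⟨F⟩⟩ := exists_reesIso hJ
      ⟨he, fun h => hN f (Or.inl hf) e h hfe⟩ hee (σ.strict q (hp.trans hpq) hqo).1
    exact ⟨H, hH, n', m', Q, F.isCSDiagonal hJ hrow hcol fun z hz => hN z (Or.inr hz), ⟨F⟩⟩
  matching := by
    intro H _ n' m' Q hQ F x₁ x₂ y₁ y₂ g g' α γ β δ h h' i k j l hx₁ hx₂ hβγ hy₁ hy₂ h₁ h₂
    have hx₁' : E.IsAt x₁ α β := ⟨g, hx₁⟩
    have hx₂' : E.IsAt x₂ γ δ := ⟨g', hx₂⟩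
    have hy₁' : F.IsAt y₁ i j := ⟨h, hy₁⟩
    have hy₂' : F.IsAt y₂ k l := ⟨h', hy₂⟩
    refine ⟨_, rfl, (hQ.rowMem_iff j k).2 ((hy₁'.mul_notMem_iff hy₂').1 fun hB => ?_)⟩
    exact hN _ (Or.inl (hx₁'.mul hx₂' hβγ).mem) _ hB ((etaStar S).mul h₁ h₂)

end EtaStar

/-! ### The main theorem -/

theorem mainTheorem5 {S : Type u} [Semigroup S] [Finite S] (σ : EtaStar.PrincipalSeries S)
    (p : ℕ) (hp : 1 ≤ p) (hpo : p ≤ σ.o)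
    {G : Type v} [Group G] {n m : ℕ} (P : Matrix (Fin m) (Fin n) (WithZero G))
    (hP : EtaStar.IsCSDiagonal P)
    (E : EtaStar.ReesIso (σ.ideal p) (σ.ideal (p + 1)) P)
    (k₁ k₂ k₃ k₄ : hP.Class) (hk : k₁ ≠ k₃)
    (v₁ v₂ : S) (hv₁ : v₁ ∉ (σ.ideal (p + 1)).carrier) (hv₂ : v₂ ∉ (σ.ideal (p + 1)).carrier)
    (h₁ : EtaStar.OrbitLE k₁ k₂ k₃ k₄ (EtaStar.Gamma hP E ((σ.ideal (p + 1)).proj v₁)))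
    (h₂ : EtaStar.OrbitLE k₁ k₄ k₃ k₂ (EtaStar.Gamma hP E ((σ.ideal (p + 1)).proj v₂))) :
    (∃ p' : ℕ, EtaStar.IsEtaRoot σ E p' ∧ p' ≠ p ∧
      ∀ (H : Type u) [Group H] (n' m' : ℕ) (Q : Matrix (Fin m') (Fin n') (WithZero H))
        (hQ : EtaStar.IsCSDiagonal Q)
        (F : EtaStar.ReesIso (σ.ideal p') (σ.ideal (p' + 1)) Q),
        ∃ φ : Fin n → hQ.Class, EtaStar.IsPhi E hQ F φ ∧
          (∀ α₁ α₃ : Fin n, hP.cls α₁ = k₁ → hP.cls α₃ = k₃ → φ α₁ = φ α₃) ∧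
          (∀ α₂ α₄ : Fin n, hP.cls α₂ = k₂ → hP.cls α₄ = k₄ → φ α₂ = φ α₄)) ∨
      EtaStar.ThetaIsRoot σ p := by
  by_cases hθ : EtaStar.ThetaIsRoot σ p
  · exact Or.inr hθ
  refine Or.inl ?_
  have h₁₂ := EtaStar.gammaRel_of_gamma_eq_some h₁.1
  have h₃₄ := EtaStar.gammaRel_of_gamma_eq_some h₁.2
  have h₁₄ := EtaStar.gammaRel_of_gamma_eq_some h₂.1
  have h₃₂ := EtaStar.gammaRel_of_gamma_eq_some h₂.2
  obtain ⟨x, y, i₁, i₃, j, j', hx, hy, rfl, rfl, hxy⟩ :=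
    EtaStar.exists_etaStar_of_gammaRel h₁₂ h₃₄ h₁₄ h₃₂
  obtain ⟨i₂, l, hvx, rfl⟩ := h₁₂.mul_isAt hx rfl
  obtain ⟨i₄, l', hvy, rfl⟩ := h₃₄.mul_isAt hy rfl
  have hvxy : EtaStar.etaStar S (v₁ * x) (v₁ * y) :=
    (EtaStar.etaStar S).mul ((EtaStar.etaStar S).refl v₁) hxy
  obtain ⟨q, hpq, hqo, hrel, hN⟩ := σ.exists_last hp hpo
  refine ⟨q, EtaStar.isEtaRoot_of_related σ hp hpq hqo hP E hθ hrel hN, ?_, ?_⟩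
  · rintro rfl
    -- With the root's coordinates taken to be `E`, reflexivity of `η*` identifies `φ` with the
    -- class map.
    obtain ⟨φ, hφ, hφ'⟩ := EtaStar.exists_isPhi (σ.isJClass hp hpo) hP E hrel
      (fun z hz => hN z (Or.inr hz)) hP E
    have hid : ∀ {s : S} {i : Fin n} {r : Fin m}, E.IsAt s i r → φ i = hP.cls i := by
      rintro s i r ⟨g, hs⟩
      exact (hφ i _).2 ⟨s, s, g, r, g, i, r, hs, hs, (EtaStar.etaStar S).refl s, rfl⟩
    exact hk (by rw [← hid hx, ← hid hy, hφ' hx hy hxy i₁ i₃ rfl rfl])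
  · intro H _ n' m' Q hQ F
    obtain ⟨φ, hφ, hφ'⟩ := EtaStar.exists_isPhi (σ.isJClass hp hpo) hP E hrel
      (fun z hz => hN z (Or.inr hz)) hQ F
    exact ⟨φ, hφ, hφ' hx hy hxy, hφ' hvx hvy hvxy⟩
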